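/- **Theorem (Symmetric function theorem).** Let $n\ge 1$ and let $\sigma=(\sigma^1,\dots,\sigma^n):\mathbb R^n\to\mathbb R^n$, where $\sigma^k(x)=\sum_{i_1<\dots<i_k}x_{i_1}\cdots x_{i_k}$ are the elementary symmetric polynomials. Let $V\subseteq\mathbb R^n$ be an open neighbourhood of $0$ and let $f:V\to\mathbb R$ be real-analytic and symmetric, i.e. $f(\pi(x))=f(x)$ for every permutation $\pi$ and every $x\in V$ with $\pi(x)\in V$, where $\pi(x)=(x_{\pi^{-1}(1)},\dots,x_{\pi^{-1}(n)})$. Then there is a real-analytic function $g$ on an open neighbourhood of $\sigma(V)$ with $f=g\circ\sigma$ on $V$. It is unique: any other such function agrees with $g$ on a neighbourhood of $\sigma(V)$, and any function $g'$ analytic at $0$ with $f=g'\circ\sigma$ near $0$ agrees with $g$ near $0$. If $f$ is (the restriction to $V$ of) a polynomial of degree $d$, then $g$ agrees on a neighbourhood of $\sigma(V)$ with a polynomial of degree at most $d$. Moreover, for $\nu\in\mathbb N^n$ write $|\nu|=\sum_i\nu_i$, $\|\nu\|=\sum_i i\,\nu_i$, $\nu!=\prod_i\nu_i!$, $x^\nu=\prod_i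 x_i^{\nu_i}$, and for $\nu,\lambda\in\mathbb N^n$ put $$A_{\nu,\lambda}=\lambda!\sum_{p(\nu,\lambda)}\ \prod_{j=1}^{s}\frac{\prod_{i=1}^n(\partial^{l_j}\sigma^i(0))^{(k_j)_i}}{k_j!\,(l_j!)^{|k_j|}},$$ where $p(\nu,\lambda)$ is the set of all finite collections ($s \ge 0$) of pairs $(k_1,l_1),\dots,(k_s,l_s)$ of nonzero elements of $\mathbb N^n$, with pairwise distinct $l_j$ and the order of the pairs disregarded, such that $\sum_j k_j=\lambda$ and $\sum_j|k_j|\,l_j=\nu$. Then near $0$ there are (absolutely convergent) expansions $f(x)=\sum_\nu f_\nu x^\nu$ and $g(y)=\sum_\lambda g_\lambda y^\lambda$, and their coefficients satisfy, for every $\nu\in\mathbb N^n$, $$f_\nu=\sum_{\|\lambda\|=|\nu|}A_{\nu,\lambda}\,g_\lambda .$$ For each $d\in\mathbb N$ the equations with $|\nu|=d$ and $\nu_1\ge\dots\ge\nu_n$ form a square unitriangular system: $\varphi(\nu)=(\nu_1-\nu_2,\dots,\nu_{n-1}-\nu_n,\nu_n)$ is a bijection from $\{\nu : \nu_1\ge\dots\ge\nu_n,\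 |\nu|=d\}$ onto $\{\lambda : \|\lambda\|=d\}$; $A_{\nu,\varphi(\nu)}=1$ for each such $\nu$; and $A_{\nu,\varphi(\mu)}=0$ for such $\nu,\mu$ whenever $\mu$ is lexicographically smaller than $\nu$. -/

import Mathlib

open Filter Topology

noncomputable section

/-- The map `σ = (σ¹, …, σⁿ) : ℝⁿ → ℝⁿ` whose components are the elementary symmetric polynomials;
the component with index `i : Fin n` is the one of degree `i + 1`. -/
def elemSymm (n : ℕ) (x : Fin n → ℝ) : Fin n → ℝ :=
  fun i => MvPolynomial.eval x (MvPolynomial.esymm (Fin n) ℝ ((i : ℕ) + 1))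

/-- `F(x) = ∑_ν a_ν x^ν` (absolutely convergent) for all `x` in a neighbourhood of the origin. -/
def HasPowerSeriesAtZero {n : ℕ} (F : (Fin n → ℝ) → ℝ) (a : (Fin n →₀ ℕ) → ℝ) : Prop :=
  ∀ᶠ x in 𝓝 (0 : Fin n → ℝ), HasSum (fun ν : Fin n →₀ ℕ => a ν * ∏ i, x i ^ ν i) (F x)

/-- The degree `|ν| = ∑ ν_i`. -/
def multiDegree {n : ℕ} (ν : Fin n →₀ ℕ) : ℕ := ∑ i, ν i

/-- The weight `‖ν‖ = ∑ i ν_i` (with `i` running from `1` to `n`). -/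
def multiWeight {n : ℕ} (ν : Fin n →₀ ℕ) : ℕ := ∑ i : Fin n, ((i : ℕ) + 1) * ν i

/-- The factorial `ν! = ∏ ν_i!`. -/
def multiFactorial {n : ℕ} (ν : Fin n →₀ ℕ) : ℕ := ∏ i, (ν i).factorial

theorem finite_multiWeight_eq (n d : ℕ) : {lam : Fin n →₀ ℕ | multiWeight lam = d}.Finite := by
  refine (Set.finite_Iic (Finsupp.equivFunOnFinite.symm (fun _ : Fin n => d))).subset ?_
  intro lam h i
  have h1 : ((i : ℕ) + 1) * lam i ≤ multiWeight lam :=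
    Finset.single_le_sum (f := fun i : Fin n => ((i : ℕ) + 1) * lam i)
      (fun _ _ => Nat.zero_le _) (Finset.mem_univ i)
  have h2 : multiWeight lam = d := h
  simp only [Finsupp.equivFunOnFinite_symm_apply_apply]
  nlinarith [Nat.zero_le ((i : ℕ) * lam i)]

/-- The finite set of all multi-indices of weight `d`. -/
def multiIndicesOfWeight (n d : ℕ) : Finset (Fin n →₀ ℕ) := (finite_multiWeight_eq n d).toFinset

/-- The index set `p(ν, λ)` of the multivariate Faà di Bruno formula. Its elements are the finite
collections of pairwise distinct nonzero multi-indices `l_1, …, l_s`, with nonzero multiplicities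
`k_1, …, k_s ∈ ℕⁿ`, such that `∑ k_j = λ` and `∑ |k_j| l_j = ν`. Such a collection is encoded as the
finitely supported function `k` with `k l_j = k_j`. (Each `l_j` is then at most `ν`.) -/
def faaDiBrunoIndex {n : ℕ} (ν lam : Fin n →₀ ℕ) : Finset ((Fin n →₀ ℕ) →₀ (Fin n →₀ ℕ)) :=
  (Finset.finsuppAntidiag ((Finset.Iic ν).erase 0) lam).filter
    (fun k => k.sum (fun l m => multiDegree m • l) = ν)

/-- The derivative `σ^i_l = ∂^l σ^i (0) = l! · [x^l] σ^i`. -/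
def elemSymmDeriv {n : ℕ} (i : Fin n) (l : Fin n →₀ ℕ) : ℝ :=
  multiFactorial l * MvPolynomial.coeff l (MvPolynomial.esymm (Fin n) ℝ ((i : ℕ) + 1))

/-- The coefficient of `g_λ` in the Faà di Bruno equation for the coefficient of `x^ν` in `g ∘ σ`:
`λ! ∑_{p(ν,λ)} ∏_j (σ_{l_j})^{k_j} / (k_j! (l_j!)^{|k_j|})`. -/
def faaDiBrunoCoeff {n : ℕ} (ν lam : Fin n →₀ ℕ) : ℝ :=
  multiFactorial lam * ∑ k ∈ faaDiBrunoIndex ν lam, k.prod (fun l m =>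
    (∏ i, elemSymmDeriv i l ^ m i) / (multiFactorial m * (multiFactorial l : ℝ) ^ multiDegree m))

/-- The map `φ(ν) = (ν_1 - ν_2, …, ν_{n-1} - ν_n, ν_n)`, used for `ν_1 ≥ … ≥ ν_n` only. -/
def diffMap {n : ℕ} (ν : Fin n →₀ ℕ) : Fin n →₀ ℕ :=
  Finsupp.equivFunOnFinite.symm
    (fun i => ν i - if h : (i : ℕ) + 1 < n then ν ⟨(i : ℕ) + 1, h⟩ else 0)

/-- The representatives `ν_1 ≥ … ≥ ν_n`, `|ν| = d`, of the multi-indices of degree `d` modulo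
permutation. -/
def decreasingOfDegree (n d : ℕ) : Set (Fin n →₀ ℕ) := {ν | Antitone ν ∧ multiDegree ν = d}

end

/-! Existence is first proved locally. Near σ(a), g is a Cauchy integral over the torus |z_i - a_i|
= ρ: g(y) is 1/N times the mean of F(z) ∏_{i≠j} (z_i - z_j) ∏_i (z_i - a_i)/P_y(z_i), where F is the
power series of f at a, P_y is the monic polynomial with coefficients ±y_i, and N is the order of
the stabilizer of a. It is analytic in y because y enters only through P_y. If y = σ(x) with x near
a and with distinct entries, partial fractions turn ∏ 1/P_y(z_i) into a sum over maps κ of simple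
poles at z_i = x_{κ(i)}. Cauchy's formula keeps the κ with a∘κ = a; the difference product kills the
non-injective κ and cancels the residue weights of the others; each survivor contributes f(x∘κ) =
f(x) (`torusMean_mul_rootKernel`). Density covers repeated entries
(`exists_analyticAt_comp_elemSymm`).

Uniqueness holds because σ is open at points with distinct entries and these are dense, so the
identity theorem recovers the germ of g from g∘σ (`eventuallyEq_of_comp_elemSymm`). Hence the local
solutions are compatible and glue along σ(V) (`exists_eventuallyEq_of_compatible_germs`).

The rest is algebra: A_{ν,λ} is the coefficient of x^ν in σ^λ (`faaDiBrunoCoeff_eq_coeff`). The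
linear system is a rearranged absolutely convergent double series, its unitriangularity is the
lexicographic leading monomial of σ^λ, and the polynomial case is the fundamental theorem on
symmetric polynomials together with the grading by weight. -/

noncomputable section

/-! ### Faà di Bruno coefficients as coefficients of products of elementary symmetric polynomials.
-/

open MvPolynomial Finset

/-- The product `∏ᵢ σⁱ ^ λᵢ` of elementary symmetric polynomials. -/
def esymmPow {n : ℕ} (lam : Fin n →₀ ℕ) : MvPolynomial (Fin n) ℝ :=
  ∏ i : Fin n, esymm (Fin n) ℝ ((i : ℕ) + 1) ^ lam i

theorem coeff_zero_esymm_succ {n : ℕ} (k : ℕ) :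
    coeff 0 (esymm (Fin n) ℝ (k + 1)) = 0 := by
  rw [← constantCoeff_eq]
  simp only [esymm, map_sum, map_prod, constantCoeff_X]
  refine Finset.sum_eq_zero fun t ht => ?_
  rw [Finset.prod_const, (Finset.mem_powersetCard.mp ht).2, zero_pow (Nat.succ_ne_zero k)]

theorem pow_sum_monomial {ι : Type*} [DecidableEq ι] (S : Finset (ι →₀ ℕ)) (c : (ι →₀ ℕ) → ℝ)
    (k : ℕ) : (∑ l ∈ S, monomial l (c l)) ^ k =
      ∑ m ∈ piAntidiag S k, monomial (∑ l ∈ S, m l • l)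
        (k.factorial * ∏ l ∈ S, c l ^ m l / (m l).factorial) := by
  rw [Finset.sum_pow_eq_sum_piAntidiag]
  refine Finset.sum_congr rfl fun m hm => ?_
  have hk : ∑ l ∈ S, m l = k := (mem_piAntidiag.mp hm).1
  have h1 : (Nat.multinomial S m : ℝ) = k.factorial * ∏ l ∈ S, (1 / (m l).factorial : ℝ) := by
    have h2 : (∏ l ∈ S, ((m l).factorial : ℝ)) ≠ 0 :=
      Finset.prod_ne_zero_iff.mpr fun l _ => by positivity
    have h3 := Nat.multinomial_spec S m
    rw [hk] at h3
    rw [← h3]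
    push_cast
    rw [Finset.prod_div_distrib]
    field_simp
    simp
  simp_rw [monomial_pow]
  rw [← monomial_sum_prod]
  rw [← map_natCast (C : ℝ →+* MvPolynomial ι ℝ), C_mul_monomial, h1, mul_assoc,
    ← Finset.prod_mul_distrib]
  congr 3
  exact funext fun l => one_div_mul_eq_div _ _

/-- Multinomial expansion: `m i l` counts how many of the `lam i` copies of the `i`-th factor
contribute their `l`-term. -/
theorem coeff_prod_pow_sum_monomial {n : ℕ} (S : Finset (Fin n →₀ ℕ))
    (c : Fin n → (Fin n →₀ ℕ) → ℝ) (lam : Fin n → ℕ) (ν : Fin n →₀ ℕ) :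
    coeff ν (∏ i, (∑ l ∈ S, monomial l (c i l)) ^ lam i) =
      ∑ m ∈ (Fintype.piFinset fun i => piAntidiag S (lam i)) with
        ∑ l ∈ S, (∑ i, m i l) • l = ν,
        (∏ i, ((lam i).factorial : ℝ)) * ∏ l ∈ S, ∏ i, c i l ^ m i l / (m i l).factorial := by
  simp_rw [pow_sum_monomial, Finset.prod_univ_sum, ← monomial_sum_prod, coeff_sum,
    coeff_monomial, Finset.sum_filter]
  refine Finset.sum_congr rfl fun m _ => ?_
  have h1 : ∑ i, ∑ l ∈ S, m i l • l = ∑ l ∈ S, (∑ i, m i l) • l := by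
    rw [Finset.sum_comm]
    simp_rw [Finset.sum_smul]
  rw [h1, Finset.prod_mul_distrib, Finset.prod_comm]

theorem esymm_eq_sum_monomial_of_support_subset {n k : ℕ} {S : Finset (Fin n →₀ ℕ)}
    (hS : (esymm (Fin n) ℝ k).support ⊆ S) :
    esymm (Fin n) ℝ k = ∑ l ∈ S, monomial l (coeff l (esymm (Fin n) ℝ k)) := by
  conv_lhs => rw [as_sum (esymm (Fin n) ℝ k)]
  exact Finset.sum_subset hS fun l _ hl => by rw [notMem_support_iff.mp hl, monomial_zero]

theorem faaDiBruno_prod_eq {n : ℕ} (k : (Fin n →₀ ℕ) →₀ (Fin n →₀ ℕ))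
    {S : Finset (Fin n →₀ ℕ)} (hS : k.support ⊆ S) :
    k.prod (fun l m =>
      (∏ i, elemSymmDeriv i l ^ m i) / (multiFactorial m * (multiFactorial l : ℝ) ^ multiDegree m)) =
    ∏ l ∈ S, ∏ i : Fin n,
      coeff l (esymm (Fin n) ℝ ((i : ℕ) + 1)) ^ k l i / ((k l i).factorial : ℝ) := by
  rw [Finsupp.prod_of_support_subset _ hS _ fun l _ => by simp [multiFactorial, multiDegree]]
  refine Finset.prod_congr rfl fun l _ => ?_
  have hl : (multiFactorial l : ℝ) ≠ 0 := by
    simp only [multiFactorial]; positivity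
  simp only [elemSymmDeriv, mul_pow, Finset.prod_mul_distrib, Finset.prod_pow_eq_pow_sum,
    multiDegree, Finset.prod_div_distrib]
  rw [mul_comm, mul_div_mul_right _ _ (pow_ne_zero _ hl)]
  simp [multiFactorial]

theorem mem_faaDiBrunoIndex {n : ℕ} {ν lam : Fin n →₀ ℕ}
    {k : (Fin n →₀ ℕ) →₀ (Fin n →₀ ℕ)} : k ∈ faaDiBrunoIndex ν lam ↔
      (((Finset.Iic ν).erase 0).sum k = lam ∧ k.support ⊆ (Finset.Iic ν).erase 0) ∧
        k.sum (fun l m => multiDegree m • l) = ν := by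
  rw [faaDiBrunoIndex, Finset.mem_filter, Finset.mem_finsuppAntidiag]

/-- Transposing `m i l` into `k l i` matches the multinomial expansion of σ^λ with p(ν, λ); the l!
in the derivatives cancel the (l_j!)^{|k_j|}. -/
theorem faaDiBrunoCoeff_eq_coeff {n : ℕ} (ν lam : Fin n →₀ ℕ) :
    faaDiBrunoCoeff ν lam = coeff ν (esymmPow lam) := by
  classical
  -- One index set serving all factors: it holds every monomial of every σ^i and all nonzero l ≤ ν.
  -- Dropping 0 is harmless since no σ^i has a constant term.
  let S : Finset (Fin n →₀ ℕ) :=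
    (Finset.Iic ν ∪ Finset.univ.biUnion
      fun i : Fin n => (esymm (Fin n) ℝ ((i : ℕ) + 1)).support).erase 0
  have hS (i : Fin n) : (esymm (Fin n) ℝ ((i : ℕ) + 1)).support ⊆ S := by
    intro l hl
    refine Finset.mem_erase.mpr ⟨?_, Finset.mem_union_right _
      (Finset.mem_biUnion.mpr ⟨i, Finset.mem_univ i, hl⟩)⟩
    rintro rfl
    exact mem_support_iff.mp hl (coeff_zero_esymm_succ _)
  have hS' : (Finset.Iic ν).erase 0 ⊆ S :=
    Finset.erase_subset_erase _ Finset.subset_union_left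
  have hpow : esymmPow lam = ∏ i : Fin n, (∑ l ∈ S,
      monomial l (coeff l (esymm (Fin n) ℝ ((i : ℕ) + 1)))) ^ lam i :=
    Finset.prod_congr rfl fun i _ => by rw [← esymm_eq_sum_monomial_of_support_subset (hS i)]
  have hmem {k : (Fin n →₀ ℕ) →₀ (Fin n →₀ ℕ)} (hk : k ∈ faaDiBrunoIndex ν lam) :
      k.support ⊆ S ∧ ∑ l ∈ S, k l = lam ∧ ∑ l ∈ S, multiDegree (k l) • l = ν := by
    obtain ⟨⟨h3, h4⟩, h2⟩ := mem_faaDiBrunoIndex.mp hk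
    refine ⟨h4.trans hS', ?_, ?_⟩
    · rw [← h3]
      refine (Finset.sum_subset hS' fun l _ hl => ?_).symm
      exact Finsupp.notMem_support_iff.mp fun h => hl (h4 h)
    · rw [← h2, Finsupp.sum_of_support_subset _ (h4.trans hS') _ fun l _ => by simp [multiDegree]]
  rw [hpow, coeff_prod_pow_sum_monomial, faaDiBrunoCoeff, Finset.mul_sum]
  refine Finset.sum_nbij (fun k i l => k l i) ?_ ?_ ?_ ?_
  · intro k hk
    obtain ⟨h1, h2, h3⟩ := hmem hk
    refine Finset.mem_filter.mpr ⟨Fintype.mem_piFinset.mpr fun i =>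
      mem_piAntidiag.mpr ⟨?_, fun l hl => h1 (Finsupp.mem_support_iff.mpr ?_)⟩, h3⟩
    · rw [← h2, Finsupp.finsetSum_apply]
    · rintro h
      simp [h] at hl
  · intro k _ k' _ h
    ext l i
    exact congrFun (congrFun h i) l
  · intro m hm
    obtain ⟨h1, h2⟩ := Finset.mem_filter.mp (Finset.mem_coe.mp hm)
    have h3 := fun i => mem_piAntidiag.mp (Fintype.mem_piFinset.mp h1 i)
    obtain ⟨k, hkm, hkS⟩ : ∃ k : (Fin n →₀ ℕ) →₀ (Fin n →₀ ℕ),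
        (∀ l i, k l i = m i l) ∧ k.support ⊆ S :=
      ⟨Finsupp.onFinset S (fun l => Finsupp.equivFunOnFinite.symm fun i => m i l) fun l hl => by
        obtain ⟨i, hi⟩ := DFunLike.ne_iff.mp hl
        exact (h3 i).2 l hi, fun _ _ => rfl, Finsupp.support_onFinset_subset⟩
    have hsum : ∑ l ∈ S, multiDegree (k l) • l = ν := by
      rw [← h2]
      simp only [multiDegree, hkm]
    -- An l that is used has |k_l| ≥ 1, so it is bounded by ∑ |k_l| l = ν.
    have hkI : k.support ⊆ (Finset.Iic ν).erase 0 := by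
      intro l hl
      refine Finset.mem_erase.mpr ⟨(Finset.mem_erase.mp (hkS hl)).1, Finset.mem_Iic.mpr ?_⟩
      rw [← hsum]
      have hd : multiDegree (k l) ≠ 0 := by
        intro h
        refine Finsupp.mem_support_iff.mp hl ?_
        ext i
        exact (Finset.sum_eq_zero_iff.mp h) i (Finset.mem_univ i)
      calc l = 1 • l := (one_smul _ _).symm
        _ ≤ multiDegree (k l) • l := by
          intro i
          simp only [Finsupp.smul_apply, smul_eq_mul]
          exact Nat.mul_le_mul_right _ (Nat.one_le_iff_ne_zero.mpr hd)
        _ ≤ _ := Finset.single_le_sum (f := fun l => multiDegree (k l) • l)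
          (fun _ _ _ => Nat.zero_le _) (hkS hl)
    refine ⟨k, Finset.mem_coe.mpr (mem_faaDiBrunoIndex.mpr ⟨⟨?_, hkI⟩, ?_⟩),
      funext fun i => funext fun l => hkm l i⟩
    · ext i
      rw [Finset.sum_subset hS' fun l _ hl =>
        Finsupp.notMem_support_iff.mp fun h => hl (hkI h), Finsupp.finsetSum_apply]
      simp only [hkm]
      exact (h3 i).1
    · rw [← hsum, Finsupp.sum_of_support_subset _ hkS _ fun l _ => by simp [multiDegree]]
  · intro k hk
    rw [faaDiBruno_prod_eq k (hmem hk).1]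
    simp [multiFactorial]

/-! ### Unitriangularity through lexicographic leading monomials. -/

theorem diffMap_eq_invAccumulate {n : ℕ} (ν : Fin n →₀ ℕ) :
    ⇑(diffMap ν) = Fin.invAccumulate n n ν := by
  ext i
  simp [diffMap, Fin.invAccumulate]

/-- Double counting: λ_i occurs in the first i of the tail sums. This is why φ turns degree into
weight. -/
theorem multiWeight_eq_sum_accumulate {n : ℕ} (lam : Fin n →₀ ℕ) :
    multiWeight lam = ∑ j, Fin.accumulate n n lam j := by
  simp only [multiWeight, Fin.accumulate_apply, Finset.sum_filter]
  rw [Finset.sum_comm]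
  refine Finset.sum_congr rfl fun i _ => ?_
  rw [← Finset.sum_filter, Finset.sum_const, smul_eq_mul]
  congr 1
  have : (Finset.univ.filter fun j : Fin n => j.val ≤ i.val) = Finset.Iic i := by
    ext j
    rw [Finset.mem_filter_univ, Finset.mem_Iic, Fin.le_def]
  rw [this, Fin.card_Iic]

theorem antitone_accumulate {n : ℕ} (t : Fin n → ℕ) : Antitone (Fin.accumulate n n t) := by
  intro i j hij
  simp only [Fin.accumulate_apply]
  refine Finset.sum_le_sum_of_subset fun k hk => ?_
  simp only [Finset.mem_filter, Finset.mem_univ, true_and] at hk ⊢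
  exact le_trans hij hk

theorem bijOn_diffMap (n d : ℕ) :
    Set.BijOn diffMap (decreasingOfDegree n d) {lam : Fin n →₀ ℕ | multiWeight lam = d} := by
  refine ⟨fun ν hν => ?_, fun ν hν μ hμ h => ?_, fun lam hlam => ?_⟩
  · change multiWeight _ = d
    rw [multiWeight_eq_sum_accumulate, diffMap_eq_invAccumulate,
      Fin.accumulate_invAccumulate le_rfl hν.1]
    exact hν.2
  · have := congrArg (fun l : Fin n →₀ ℕ => Fin.accumulate n n l) h
    simp only [diffMap_eq_invAccumulate] at this
    rw [Fin.accumulate_invAccumulate le_rfl hν.1, Fin.accumulate_invAccumulate le_rfl hμ.1] at this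
    exact DFunLike.coe_injective this
  · refine ⟨Finsupp.equivFunOnFinite.symm (Fin.accumulate n n lam), ⟨?_, ?_⟩, ?_⟩
    · exact antitone_accumulate _
    · rw [← show multiWeight lam = d from hlam, multiWeight_eq_sum_accumulate]
      rfl
    · apply DFunLike.coe_injective
      apply Fin.accumulate_injective le_rfl
      rw [diffMap_eq_invAccumulate, Fin.accumulate_invAccumulate le_rfl]
      · rfl
      · exact antitone_accumulate _

theorem esymmAlgHomMonomial_one_eq_esymmPow {n : ℕ} (lam : Fin n →₀ ℕ) :
    esymmAlgHomMonomial (Fin n) lam (1 : ℝ) = esymmPow lam := by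
  rw [esymmAlgHomMonomial, esymmAlgHom_apply, aeval_monomial, map_one, one_mul,
    Finsupp.prod_fintype _ _ (by simp)]
  rfl

/-- The leading exponent of σ^λ consists of the tail sums of λ, and on decreasing sequences φ
inverts taking tail sums. -/
theorem ofLex_supDegree_esymmPow_diffMap {n : ℕ} {ν : Fin n →₀ ℕ} (hν : Antitone ν) :
    ofLex (AddMonoidAlgebra.supDegree toLex (esymmPow (diffMap ν))) = ν := by
  apply DFunLike.coe_injective
  rw [← esymmAlgHomMonomial_one_eq_esymmPow, supDegree_esymmAlgHomMonomial one_ne_zero _ le_rfl,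
    diffMap_eq_invAccumulate, Fin.accumulate_invAccumulate le_rfl hν]

theorem coeff_esymmPow_diffMap_self {n : ℕ} {ν : Fin n →₀ ℕ} (hν : Antitone ν) :
    coeff ν (esymmPow (diffMap ν)) = 1 := by
  have h := leadingCoeff_esymmAlgHomMonomial (r := (1 : ℝ)) (diffMap ν) le_rfl
  rw [esymmAlgHomMonomial_one_eq_esymmPow, leadingCoeff_toLex,
    ofLex_supDegree_esymmPow_diffMap hν] at h
  exact h

theorem coeff_esymmPow_diffMap_of_lt {n : ℕ} {ν μ : Fin n →₀ ℕ} (hμ : Antitone μ)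
    (h : toLex μ < toLex ν) : coeff ν (esymmPow (diffMap μ)) = 0 := by
  refine AddMonoidAlgebra.coeff_eq_zero_of_not_le_supDegree (D := toLex) ?_
  have := ofLex_supDegree_esymmPow_diffMap hμ
  rw [← toLex_ofLex (AddMonoidAlgebra.supDegree toLex (esymmPow (diffMap μ))), this]
  exact not_le.mpr h

theorem isHomogeneous_esymm {n : ℕ} (k : ℕ) : (esymm (Fin n) ℝ k).IsHomogeneous k := by
  refine IsHomogeneous.sum _ _ _ fun t ht => ?_
  have h := IsHomogeneous.prod t (fun i => (X i : MvPolynomial (Fin n) ℝ)) (fun _ => 1)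
    fun _ _ => isHomogeneous_X ℝ _
  rwa [Finset.sum_const, (Finset.mem_powersetCard.mp ht).2, smul_eq_mul, mul_one] at h

theorem isHomogeneous_esymmPow {n : ℕ} (lam : Fin n →₀ ℕ) :
    (esymmPow lam).IsHomogeneous (multiWeight lam) :=
  IsHomogeneous.prod _ _ _ fun _ _ => (isHomogeneous_esymm _).pow _

/-- Nonnegativity lets the absolute values of the terms of σ(x)^λ sum to σ(|x|)^λ in the convergence
proof. -/
theorem coeff_esymmPow_nonneg {n : ℕ} (lam ν : Fin n →₀ ℕ) : 0 ≤ coeff ν (esymmPow lam) := by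
  have h : esymmPow lam = map (Nat.castRingHom ℝ)
      (∏ i : Fin n, esymm (Fin n) ℕ ((i : ℕ) + 1) ^ lam i) := by
    rw [map_prod, esymmPow]
    simp_rw [map_pow, map_esymm]
  rw [h, coeff_map]
  exact Nat.cast_nonneg _

theorem coeff_esymmPow_eq_zero {n : ℕ} {lam ν : Fin n →₀ ℕ}
    (h : multiDegree ν ≠ multiWeight lam) : coeff ν (esymmPow lam) = 0 := by
  refine (isHomogeneous_esymmPow lam).coeff_eq_zero ?_
  rwa [Finsupp.degree_eq_sum]

theorem eval_esymmPow {n : ℕ} (lam : Fin n →₀ ℕ) (x : Fin n → ℝ) :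
    eval x (esymmPow lam) = ∏ i, elemSymm n x i ^ lam i := by
  simp only [esymmPow, map_prod, map_pow, elemSymm]

/-! ### Symmetric polynomials and the degree bound. -/

/-- The substitution of the elementary symmetric polynomials for the variables. -/
def esymmSubst (n : ℕ) : MvPolynomial (Fin n) ℝ →ₐ[ℝ] MvPolynomial (Fin n) ℝ :=
  aeval fun i : Fin n => esymm (Fin n) ℝ ((i : ℕ) + 1)

theorem esymmSubst_injective (n : ℕ) : Function.Injective (esymmSubst n) := by
  intro p q h
  refine esymmAlgHom_fin_injective ℝ (le_refl n) (Subtype.ext ?_)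
  rw [esymmAlgHom_apply, esymmAlgHom_apply]
  exact h

theorem exists_esymmSubst_eq {n : ℕ} {p : MvPolynomial (Fin n) ℝ} (hp : p.IsSymmetric) :
    ∃ q, esymmSubst n q = p := by
  obtain ⟨q, hq⟩ := (esymmAlgHom_fin_bijective ℝ n).2 ⟨p, hp⟩
  refine ⟨q, ?_⟩
  rw [esymmSubst, ← esymmAlgHom_apply, hq]

theorem eval_esymmSubst {n : ℕ} (q : MvPolynomial (Fin n) ℝ) (x : Fin n → ℝ) :
    eval x (esymmSubst n q) = eval (elemSymm n x) q := by
  induction q using MvPolynomial.induction_on with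
  | C r => simp [esymmSubst]
  | add p q hp hq => rw [map_add, map_add, hp, hq, map_add]
  | mul_X p i hp => rw [map_mul, map_mul, hp, map_mul, eval_X]; simp [esymmSubst, elemSymm]

theorem esymmSubst_monomial {n : ℕ} (lam : Fin n →₀ ℕ) (r : ℝ) :
    esymmSubst n (monomial lam r) = C r * esymmPow lam := by
  rw [esymmSubst, aeval_monomial, Finsupp.prod_fintype _ _ (by simp)]
  rfl

theorem multiDegree_le_multiWeight {n : ℕ} (lam : Fin n →₀ ℕ) :
    multiDegree lam ≤ multiWeight lam :=
  Finset.sum_le_sum fun _ _ => Nat.le_mul_of_pos_left _ (Nat.succ_pos _)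

/-- Substitution turns weight into degree, so parts of different weights cannot cancel. -/
theorem homogeneousComponent_esymmSubst {n : ℕ} (d : ℕ) (q : MvPolynomial (Fin n) ℝ) :
    homogeneousComponent d (esymmSubst n q) =
      esymmSubst n (∑ lam ∈ q.support with multiWeight lam = d, monomial lam (coeff lam q)) := by
  conv_lhs => rw [as_sum q]
  simp_rw [map_sum, esymmSubst_monomial, homogeneousComponent_C_mul, Finset.sum_filter]
  refine Finset.sum_congr rfl fun lam _ => ?_
  rw [homogeneousComponent_of_mem ((mem_homogeneousSubmodule _ _).mpr (isHomogeneous_esymmPow lam))]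
  simp only [eq_comm (a := d)]
  split_ifs <;> simp

/-- If λ occurs in q, the weight-‖λ‖ part of q is nonzero, and by injectivity so is its image, which
has degree ‖λ‖ ≥ |λ|. -/
theorem totalDegree_le_totalDegree_esymmSubst {n : ℕ} (q : MvPolynomial (Fin n) ℝ) :
    q.totalDegree ≤ (esymmSubst n q).totalDegree := by
  rw [totalDegree_eq]
  refine Finset.sup_le fun lam hlam => ?_
  have hdeg : lam.toMultiset.card = multiDegree lam := by
    rw [Finsupp.card_toMultiset, Finsupp.sum_fintype _ _ (by simp)]
    rfl
  rw [hdeg]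
  refine (multiDegree_le_multiWeight lam).trans (not_lt.mp fun hlt => ?_)
  have h := homogeneousComponent_eq_zero _ _ hlt
  rw [homogeneousComponent_esymmSubst] at h
  have h2 := congrArg (coeff lam) (esymmSubst_injective n (h.trans (map_zero _).symm))
  rw [coeff_sum, coeff_zero, Finset.sum_eq_single lam] at h2
  · rw [coeff_monomial, if_pos rfl] at h2
    exact mem_support_iff.mp hlam h2
  · intro b _ hb
    rw [coeff_monomial, if_neg hb]
  · intro h3
    exact (h3 (Finset.mem_filter.mpr ⟨hlam, rfl⟩)).elim

theorem eq_of_eventually_eval_eq {n : ℕ} {p q : MvPolynomial (Fin n) ℝ} {a : Fin n → ℝ}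
    (h : ∀ᶠ x in 𝓝 a, eval x p = eval x q) : p = q := by
  obtain ⟨ε, hε, hb⟩ := Metric.eventually_nhds_iff_ball.mp h
  refine funext_set (fun i => Metric.ball (a i) ε) (fun i => ?_) fun x hx => hb x ?_
  · rw [Real.ball_eq_Ioo]
    exact Set.Ioo_infinite (by linarith)
  · rw [Metric.mem_ball, dist_pi_lt_iff hε]
    exact fun i => hx i (Set.mem_univ i)

theorem continuous_perm_comp {n : ℕ} (π : Equiv.Perm (Fin n)) :
    Continuous fun (x : Fin n → ℝ) i => x (π i) :=
  continuous_pi fun i => continuous_apply (π i)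

theorem isSymmetric_of_eventually {n : ℕ} {p : MvPolynomial (Fin n) ℝ}
    (h : ∀ π : Equiv.Perm (Fin n), ∀ᶠ x in 𝓝 (0 : Fin n → ℝ),
      eval (fun i => x (π i)) p = eval x p) : p.IsSymmetric := by
  intro π
  refine eq_of_eventually_eval_eq ((h π).mono fun x hx => ?_)
  rw [eval_rename]
  exact hx

end

/-! ### From formal multilinear series to series of monomials. -/

noncomputable section

open Finset

/-- The multi-index counting how often each variable occurs in a word. -/
def wordType {n : ℕ} (w : Σ m : ℕ, Fin m → Fin n) : Fin n →₀ ℕ :=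
  Finsupp.equivFunOnFinite.symm fun i => ∑ j, if w.2 j = i then 1 else 0

theorem prod_pow_wordType {n : ℕ} {R : Type*} [CommMonoid R] (x : Fin n → R)
    (w : Σ m : ℕ, Fin m → Fin n) : ∏ i, x i ^ wordType w i = ∏ j, x (w.2 j) := by
  simp only [wordType, Finsupp.equivFunOnFinite_symm_apply_apply, ← Finset.prod_pow_eq_pow_sum]
  rw [Finset.prod_comm]
  refine Finset.prod_congr rfl fun j _ => ?_
  rw [Finset.prod_eq_single (w.2 j) (fun b _ hb => by rw [if_neg hb.symm, pow_zero])
    (fun h => (h (Finset.mem_univ _)).elim), if_pos rfl, pow_one]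

theorem multiDegree_wordType {n : ℕ} (w : Σ m : ℕ, Fin m → Fin n) :
    multiDegree (wordType w) = w.1 := by
  simp only [multiDegree, wordType, Finsupp.equivFunOnFinite_symm_apply_apply]
  rw [Finset.sum_comm]
  simp

theorem prod_const_pow_eq {n : ℕ} {R : Type*} [CommMonoid R] (r : R) (ν : Fin n →₀ ℕ) :
    ∏ i, r ^ ν i = r ^ multiDegree ν :=
  Finset.prod_pow_eq_pow_sum _ _ _

theorem prod_norm_pow_le {n : ℕ} {𝕜 : Type*} [NormedField 𝕜] {x : Fin n → 𝕜} {ρ : ℝ}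
    (hx : ‖x‖ ≤ ρ) (ν : Fin n →₀ ℕ) : ‖∏ i, x i ^ ν i‖ ≤ ρ ^ multiDegree ν := by
  rw [norm_prod, ← prod_const_pow_eq]
  refine Finset.prod_le_prod (fun _ _ => norm_nonneg _) fun i _ => ?_
  rw [norm_pow]
  exact pow_le_pow_left₀ (norm_nonneg _) ((norm_le_pi_norm x i).trans hx) _

/-- The value of a formal multilinear series on the word of unit vectors `w`. -/
def wordCoeff {n : ℕ} (p : FormalMultilinearSeries ℝ (Fin n → ℝ) ℝ)
    (w : Σ m : ℕ, Fin m → Fin n) : ℝ :=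
  p w.1 fun j => Pi.single (w.2 j) 1

theorem apply_eq_sum_wordCoeff {n : ℕ} (p : FormalMultilinearSeries ℝ (Fin n → ℝ) ℝ) (m : ℕ)
    (x : Fin n → ℝ) :
    p m (fun _ => x) = ∑ s : Fin m → Fin n, wordCoeff p ⟨m, s⟩ * ∏ j, x (s j) := by
  have hx : (fun _ : Fin m => x) = fun _ => ∑ i, x i • (Pi.single i (1 : ℝ) : Fin n → ℝ) := by
    funext _
    exact pi_eq_sum_univ' x
  rw [hx, (p m).map_sum]
  refine Finset.sum_congr rfl fun s _ => ?_
  rw [(p m).map_smul_univ, smul_eq_mul, mul_comm]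
  rfl

theorem abs_wordCoeff_le {n : ℕ} (p : FormalMultilinearSeries ℝ (Fin n → ℝ) ℝ)
    (w : Σ m : ℕ, Fin m → Fin n) : |wordCoeff p w| ≤ ‖p w.1‖ := by
  refine ((p w.1).le_opNorm _).trans ?_
  refine mul_le_of_le_one_right (norm_nonneg _) (Finset.prod_le_one (fun _ _ => norm_nonneg _) ?_)
  intro j _
  rw [Pi.norm_single, norm_one]

/-- There are n^m words of length m, and shrinking the radius to r/(n+1) absorbs this factor; n+1
keeps the denominator nonzero. -/
theorem summable_wordCoeff {n : ℕ} {p : FormalMultilinearSeries ℝ (Fin n → ℝ) ℝ} {r : NNReal}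
    (hr : (r : ENNReal) < p.radius) :
    Summable fun w : Σ m : ℕ, Fin m → Fin n => |wordCoeff p w| * (r / (n + 1) : ℝ) ^ w.1 := by
  have hr0 : (0 : ℝ) ≤ r / (n + 1) := by positivity
  refine (summable_sigma_of_nonneg fun w => by positivity).mpr
    ⟨fun m => Summable.of_finite, ?_⟩
  refine Summable.of_nonneg_of_le (fun m => tsum_nonneg fun s => by positivity) (fun m => ?_)
    (p.summable_norm_mul_pow hr)
  rw [tsum_fintype]
  calc ∑ s : Fin m → Fin n, |wordCoeff p ⟨m, s⟩| * (r / (n + 1) : ℝ) ^ m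
      ≤ ∑ _s : Fin m → Fin n, ‖p m‖ * (r / (n + 1) : ℝ) ^ m :=
        Finset.sum_le_sum fun s _ =>
          mul_le_mul_of_nonneg_right (abs_wordCoeff_le p ⟨m, s⟩) (by positivity)
    _ = ‖p m‖ * (n * (r / (n + 1) : ℝ)) ^ m := by
        rw [Finset.sum_const, Finset.card_univ, Fintype.card_fun, Fintype.card_fin,
          Fintype.card_fin, nsmul_eq_mul, mul_pow]
        push_cast
        ring
    _ ≤ ‖p m‖ * (r : ℝ) ^ m := by
        refine mul_le_mul_of_nonneg_left (pow_le_pow_left₀ (by positivity) ?_ m) (norm_nonneg _)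
        rw [mul_div_assoc', div_le_iff₀ (by positivity)]
        nlinarith [r.coe_nonneg]

/-- Words with the same letter counts give the same monomial, so c is the sum of u over the fibres
of `wordType`. -/
theorem hasSum_of_hasSum_words {n : ℕ} {u : (Σ m : ℕ, Fin m → Fin n) → ℝ} {ρ : ℝ} (hρ : 0 < ρ)
    (hu : Summable fun w => |u w| * ρ ^ w.1) : ∃ c : (Fin n →₀ ℕ) → ℝ,
      Summable (fun ν => |c ν| * ρ ^ multiDegree ν) ∧
      ∀ (x : Fin n → ℝ) (S : ℝ), HasSum (fun w => u w * ∏ j, x (w.2 j)) S →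
        HasSum (fun ν => c ν * ∏ i, x i ^ ν i) S := by
  let T : (Σ m : ℕ, Fin m → Fin n) → (Fin n →₀ ℕ) := wordType
  have hfib : Summable fun w : Σ ν : Fin n →₀ ℕ, {w // T w = ν} =>
      |u w.2.1| * ρ ^ multiDegree w.1 := by
    refine ((Equiv.sigmaFiberEquiv T).summable_iff.mpr hu).congr ?_
    rintro ⟨ν, w, rfl⟩
    change |u w| * ρ ^ w.1 = |u w| * ρ ^ multiDegree (wordType w)
    rw [multiDegree_wordType]
  have hfib1 (ν : Fin n →₀ ℕ) : Summable fun w : {w // T w = ν} => |u w.1| :=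
    (summable_mul_right_iff (pow_ne_zero (multiDegree ν) hρ.ne')).mp (hfib.sigma_factor ν)
  obtain ⟨c, hc⟩ : ∃ c : (Fin n →₀ ℕ) → ℝ,
      ∀ ν, HasSum (fun w : {w // T w = ν} => u w.1) (c ν) :=
    ⟨fun ν => ∑' w : {w // T w = ν}, u w.1, fun ν => (summable_abs_iff.mp (hfib1 ν)).hasSum⟩
  refine ⟨c, ?_, fun x S hS => ?_⟩
  · have h (ν : Fin n →₀ ℕ) : |c ν| ≤ ∑' w : {w // T w = ν}, |u w.1| := by
      rw [← (hc ν).tsum_eq]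
      have h1 := norm_tsum_le_tsum_norm (f := fun w : {w // T w = ν} => u w.1)
        (by simpa only [Real.norm_eq_abs] using hfib1 ν)
      simpa only [Real.norm_eq_abs] using h1
    have h2 : Summable fun ν => (∑' w : {w // T w = ν}, |u w.1|) * ρ ^ multiDegree ν :=
      hfib.sigma.congr fun ν =>
        tsum_mul_right (f := fun w : {w // T w = ν} => |u w.1|) (a := ρ ^ multiDegree ν)
    exact Summable.of_nonneg_of_le
      (fun ν => mul_nonneg (abs_nonneg _) (pow_nonneg hρ.le _))
      (fun ν => mul_le_mul_of_nonneg_right (h ν) (pow_nonneg hρ.le _)) h2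
  · refine ((Equiv.sigmaFiberEquiv T).hasSum_iff.mpr hS).sigma fun ν => ?_
    refine ((hc ν).mul_right (∏ i, x i ^ ν i)).congr_fun ?_
    rintro ⟨w, rfl⟩
    change u w * ∏ j, x (w.2 j) = u w * ∏ i, x i ^ wordType w i
    rw [prod_pow_wordType]

/-- A real function which is analytic at `a` is the sum of an absolutely convergent series of
monomials on a closed polydisc around `a`. -/
theorem AnalyticAt.exists_hasSum_monomials {n : ℕ} {f : (Fin n → ℝ) → ℝ} {a : Fin n → ℝ}
    (hf : AnalyticAt ℝ f a) : ∃ ρ : ℝ, 0 < ρ ∧ ∃ c : (Fin n →₀ ℕ) → ℝ,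
      Summable (fun ν => |c ν| * ρ ^ multiDegree ν) ∧
      ∀ x : Fin n → ℝ, ‖x‖ ≤ ρ → HasSum (fun ν => c ν * ∏ i, x i ^ ν i) (f (a + x)) := by
  obtain ⟨p, R, hp⟩ := hf
  obtain ⟨r, hr0, hrR⟩ := ENNReal.lt_iff_exists_nnreal_btwn.mp hp.r_pos
  have hr0' : (0 : ℝ) < r := by exact_mod_cast hr0
  have hu := summable_wordCoeff (hrR.trans_le hp.r_le)
  set ρ : ℝ := r / (n + 1)
  have hρ : 0 < ρ := by positivity
  have hρr : ρ ≤ r := div_le_self hr0'.le (by linarith [(Nat.cast_nonneg n : (0 : ℝ) ≤ n)])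
  obtain ⟨c, hc, hcS⟩ := hasSum_of_hasSum_words hρ hu
  refine ⟨ρ, hρ, c, hc, fun x hx => hcS x _ ?_⟩
  have hsum : Summable fun w : Σ m : ℕ, Fin m → Fin n => wordCoeff p w * ∏ j, x (w.2 j) := by
    refine Summable.of_norm_bounded hu fun w => ?_
    rw [norm_mul, ← prod_pow_wordType, ← multiDegree_wordType w]
    exact mul_le_mul_of_nonneg_left (prod_norm_pow_le hx _) (abs_nonneg _)
  have hxR : x ∈ Metric.eball (0 : Fin n → ℝ) R := by
    rw [mem_eball_zero_iff]
    refine lt_of_le_of_lt ?_ hrR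
    rw [← ofReal_norm, ← ENNReal.ofReal_coe_nnreal]
    exact ENNReal.ofReal_le_ofReal (hx.trans hρr)
  have h2 := hsum.hasSum.sigma fun m => hasSum_fintype _
  have h3 := hp.hasSum hxR
  simp_rw [apply_eq_sum_wordCoeff] at h3
  rw [← h2.unique h3]
  exact hsum.hasSum

end

/-! ### The map σ: fibres, properness, openness at points with distinct entries. -/

noncomputable section

open Polynomial Finset

theorem analyticAt_elemSymm {n : ℕ} (x : Fin n → ℝ) : AnalyticAt ℝ (elemSymm n) x := by
  refine AnalyticAt.pi fun i => ?_
  exact AnalyticOnNhd.eval_mvPolynomial _ x (Set.mem_univ x)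

theorem continuous_elemSymm (n : ℕ) : Continuous (elemSymm n) :=
  continuous_iff_continuousAt.mpr fun x => (analyticAt_elemSymm x).continuousAt

theorem elemSymm_zero (n : ℕ) : elemSymm n 0 = 0 := by
  funext i
  change MvPolynomial.eval 0 _ = 0
  rw [MvPolynomial.eval_zero, MvPolynomial.constantCoeff_eq, coeff_zero_esymm_succ]

theorem elemSymm_comp_perm {n : ℕ} (π : Equiv.Perm (Fin n)) (x : Fin n → ℝ) :
    elemSymm n (fun i => x (π i)) = elemSymm n x := by
  funext i
  change MvPolynomial.eval (x ∘ π) _ = _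
  rw [← MvPolynomial.eval_rename, MvPolynomial.rename_esymm]
  rfl

theorem elemSymm_eq_esymm {n : ℕ} (x : Fin n → ℝ) (i : Fin n) :
    elemSymm n x i = (Finset.univ.val.map x).esymm (i + 1) := by
  rw [← MvPolynomial.aeval_esymm_eq_multiset_esymm (Fin n) ℝ, MvPolynomial.aeval_eq_eval]
  rfl

/-- The monic polynomial whose lower coefficients are, up to sign, the entries of `y`, so that
its roots are `x₁, …, xₙ` if `y = σ(x)`. -/
def rootPoly {n : ℕ} (y : Fin n → ℝ) : ℝ[X] :=
  X ^ n + ∑ i : Fin n, C ((-1) ^ ((i : ℕ) + 1) * y i) * X ^ (n - ((i : ℕ) + 1))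

theorem rootPoly_elemSymm {n : ℕ} (x : Fin n → ℝ) :
    rootPoly (elemSymm n x) = ∏ i, (X - C (x i)) := by
  have h := Multiset.prod_X_sub_X_eq_sum_esymm (Finset.univ.val.map x)
  rw [Multiset.map_map, Multiset.card_map, Finset.card_val, Finset.card_univ, Fintype.card_fin,
    Finset.sum_range_succ', Finset.sum_range] at h
  rw [rootPoly, Finset.prod]
  refine Eq.trans ?_ h.symm
  rw [add_comm]
  congr 1
  · refine Finset.sum_congr rfl fun i _ => ?_
    rw [elemSymm_eq_esymm, C_mul, C_pow, C_neg, C_1, mul_assoc]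
  · simp [Multiset.esymm]

theorem exists_perm_of_map_univ_eq {ι α : Type*} [Fintype ι] {x y : ι → α}
    (h : Finset.univ.val.map x = Finset.univ.val.map y) :
    ∃ π : Equiv.Perm ι, x = fun i => y (π i) := by
  classical
  have hc (c : α) : Nonempty ({i // x i = c} ≃ {i // y i = c}) := by
    have := congrArg (Multiset.count c) h
    rw [Multiset.count_map, Multiset.count_map] at this
    refine ⟨Fintype.equivOfCardEq ?_⟩
    rw [Fintype.card_subtype, Fintype.card_subtype]
    simpa only [eq_comm (a := c)] using! this
  refine ⟨Equiv.ofFiberEquiv fun c => (hc c).some, funext fun i => ?_⟩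
  exact (Equiv.ofFiberEquiv_map _ i).symm

/-- σ(x) determines ∏ (X - x_i), hence the multiset of its roots. -/
theorem exists_perm_of_elemSymm_eq {n : ℕ} {x y : Fin n → ℝ} (h : elemSymm n x = elemSymm n y) :
    ∃ π : Equiv.Perm (Fin n), x = fun i => y (π i) := by
  refine exists_perm_of_map_univ_eq ?_
  have h2 := congrArg (fun z => (rootPoly z).roots) h
  have h3 (z : Fin n → ℝ) : (∏ i, (X - C (z i))).roots = Finset.univ.val.map z := by
    rw [← roots_multiset_prod_X_sub_C (Finset.univ.val.map z), Multiset.map_map]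
    rfl
  simpa only [rootPoly_elemSymm, h3] using h2

/-- Beyond this bound the leading term dominates the others. It confines the fibres of σ to balls,
which supplies compactness. -/
theorem abs_le_of_rootPoly_isRoot {n : ℕ} {y : Fin n → ℝ} {t : ℝ} (h : (rootPoly y).eval t = 0) :
    |t| ≤ 1 + ∑ i, |y i| := by
  by_contra! hlt
  have hs : 0 ≤ ∑ i, |y i| := Finset.sum_nonneg fun _ _ => abs_nonneg _
  have ht : 1 ≤ |t| := by linarith
  have h1 : t ^ n = -∑ i : Fin n, (-1) ^ ((i : ℕ) + 1) * y i * t ^ (n - ((i : ℕ) + 1)) := by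
    rw [rootPoly, eval_add, eval_pow, eval_X, eval_finsetSum] at h
    simp only [eval_mul, eval_C, eval_pow, eval_X] at h
    linarith
  rcases Nat.eq_zero_or_pos n with rfl | hn
  · simp at h1
  have h2 : |t| ^ n ≤ (∑ i, |y i|) * |t| ^ (n - 1) := by
    rw [← abs_pow, h1, abs_neg, Finset.sum_mul]
    refine (Finset.abs_sum_le_sum_abs _ _).trans (Finset.sum_le_sum fun i _ => ?_)
    rw [abs_mul, abs_mul, abs_pow, abs_neg, abs_one, one_pow, one_mul, abs_pow]
    exact mul_le_mul_of_nonneg_left (pow_le_pow_right₀ ht (by omega)) (abs_nonneg _)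
  have h3 : |t| ^ n = |t| * |t| ^ (n - 1) := by
    rw [← pow_succ', Nat.sub_add_cancel hn]
  rw [h3] at h2
  have := le_of_mul_le_mul_right h2 (by positivity)
  linarith

theorem norm_le_of_elemSymm {n : ℕ} (x : Fin n → ℝ) : ‖x‖ ≤ 1 + ∑ i, |elemSymm n x i| := by
  refine (pi_norm_le_iff_of_nonneg (by positivity)).mpr fun i => ?_
  refine abs_le_of_rootPoly_isRoot ?_
  rw [rootPoly_elemSymm, eval_prod]
  exact Finset.prod_eq_zero (Finset.mem_univ i) (by simp)

/-- Points whose image under `σ` is close to `σ(a)` are close to a permutation of `a`. -/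
theorem eventually_exists_perm_mem {n : ℕ} {a : Fin n → ℝ} {N : Set (Fin n → ℝ)} (hN : IsOpen N)
    (ha : a ∈ N) : ∀ᶠ y in 𝓝 (elemSymm n a), ∀ b, elemSymm n b = y →
      ∃ π : Equiv.Perm (Fin n), (fun i => b (π i)) ∈ N := by
  let R : ℝ := 2 + ∑ i, |elemSymm n a i|
  -- K is compact, so σ(K) is closed, and it misses σ(a). As R exceeds the root bound for y near
  -- σ(a), a preimage of y with no permutation in N would lie in K.
  let K : Set (Fin n → ℝ) :=
    Metric.closedBall 0 R ∩ {b | ∀ π : Equiv.Perm (Fin n), (fun i => b (π i)) ∉ N}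
  have hK : IsCompact K := by
    refine (isCompact_closedBall _ _).inter_right ?_
    simp only [Set.ofPred_forall]
    exact isClosed_iInter fun π => (hN.preimage (continuous_perm_comp π)).isClosed_compl
  have hmem : elemSymm n a ∉ elemSymm n '' K := by
    rintro ⟨b, hb, hba⟩
    obtain ⟨π, hπ⟩ := exists_perm_of_elemSymm_eq hba.symm
    exact hb.2 π (hπ ▸ ha)
  have h1 : ∀ᶠ y in 𝓝 (elemSymm n a), y ∉ elemSymm n '' K :=
    (hK.image (continuous_elemSymm n)).isClosed.isOpen_compl.mem_nhds hmem
  have h2 : ∀ᶠ y in 𝓝 (elemSymm n a), 1 + ∑ i, |y i| < R := by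
    refine (Continuous.tendsto (f := fun y : Fin n → ℝ => 1 + ∑ i, |y i|) (by fun_prop)
      _).eventually_lt_const ?_
    simp only [R]
    linarith
  filter_upwards [h1, h2] with y hy1 hy2 b hb
  by_contra! h
  refine hy1 ⟨b, ⟨?_, h⟩, hb⟩
  rw [mem_closedBall_zero_iff]
  exact (norm_le_of_elemSymm b).trans (hb ▸ hy2.le)

theorem frequently_injective {n : ℕ} (a : Fin n → ℝ) :
    ∃ᶠ x in 𝓝 a, Function.Injective x := by
  -- Along this line equal entries separate for every t ≠ 0, and distinct ones stay distinct for
  -- small t.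
  let γ : ℝ → Fin n → ℝ := fun t i => a i + t * (i : ℕ)
  have hγ : Tendsto γ (𝓝[≠] 0) (𝓝 a) := by
    have h : Continuous γ := by fun_prop
    have h2 := h.tendsto 0
    rw [show γ 0 = a by funext i; simp [γ]] at h2
    exact h2.mono_left nhdsWithin_le_nhds
  refine hγ.frequently (Eventually.frequently ?_)
  have h : ∀ i j : Fin n, i ≠ j → ∀ᶠ t in 𝓝[≠] (0 : ℝ), γ t i ≠ γ t j := by
    intro i j hij
    have hij' : ((i : ℕ) : ℝ) - (j : ℕ) ≠ 0 := by
      rw [sub_ne_zero]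
      exact_mod_cast fun h => hij (Fin.ext h)
    by_cases haij : a i = a j
    · filter_upwards [self_mem_nhdsWithin] with t ht h
      have : t * (((i : ℕ) : ℝ) - (j : ℕ)) = 0 := by
        simp only [γ] at h
        linear_combination h - haij
      rcases mul_eq_zero.mp this with h | h
      · exact ht h
      · exact hij' h
    · have h1 : Tendsto (fun t => γ t i) (𝓝[≠] 0) (𝓝 (a i)) :=
        ((continuous_apply i).tendsto a).comp hγ
      have h2 : Tendsto (fun t => γ t j) (𝓝[≠] 0) (𝓝 (a j)) :=
        ((continuous_apply j).tendsto a).comp hγ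
      have h3 := (h1.sub h2).eventually_ne (sub_ne_zero.mpr haij)
      exact h3.mono fun t ht => sub_ne_zero.mp ht
  have h' : ∀ᶠ t in 𝓝[≠] (0 : ℝ), ∀ i j : Fin n, i ≠ j → γ t i ≠ γ t j := by
    simpa only [eventually_all] using h
  exact h'.mono fun t ht i j hij => by_contra fun hne => ht i j hne hij

theorem hasDerivAt_eval_rootPoly {n : ℕ} {y : ℝ → Fin n → ℝ} {y' : Fin n → ℝ} {s : ℝ}
    (hy : HasDerivAt y y' s) (t : ℝ) :
    HasDerivAt (fun s => (rootPoly (y s)).eval t)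
      (∑ i : Fin n, (-1) ^ ((i : ℕ) + 1) * y' i * t ^ (n - ((i : ℕ) + 1))) s := by
  simp only [rootPoly, eval_add, eval_pow, eval_X, eval_finsetSum, eval_mul, eval_C]
  refine HasDerivAt.const_add _ (HasDerivAt.fun_sum fun i _ => ?_)
  exact (((hasDerivAt_pi.mp hy) i).const_mul _).mul_const _

/-- The derivative of σ is injective, hence surjective: if it kills v, then s ↦ ∏_i (x_k - x_i - s
v_i) has derivative 0 at 0, but the product rule gives -v_k ∏_{i≠k} (x_k - x_i). -/
theorem map_nhds_elemSymm {n : ℕ} {x : Fin n → ℝ} (hx : Function.Injective x) :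
    map (elemSymm n) (𝓝 x) = 𝓝 (elemSymm n x) := by
  have hd : HasStrictFDerivAt (elemSymm n) (fderiv ℝ (elemSymm n) x) x :=
    (analyticAt_elemSymm x).hasStrictFDerivAt
  refine hd.map_nhds_eq_of_surj ?_
  rw [LinearMap.range_eq_top]
  refine LinearMap.injective_iff_surjective.mp ?_
  rw [injective_iff_map_eq_zero]
  intro v hv
  funext k
  have hline : HasDerivAt (fun s : ℝ => x + s • v) v 0 := by
    simpa using! ((hasDerivAt_id (0 : ℝ)).smul_const v).const_add x
  have h1 : HasDerivAt (fun s : ℝ => elemSymm n (x + s • v)) 0 0 := by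
    have h2 : HasFDerivAt (elemSymm n) (fderiv ℝ (elemSymm n) x) (x + (0 : ℝ) • v) := by
      simpa using hd.hasFDerivAt
    have h3 := h2.comp_hasDerivAt 0 hline
    rwa [show fderiv ℝ (elemSymm n) x v = 0 from hv] at h3
  have h4 := hasDerivAt_eval_rootPoly h1 (x k)
  simp only [rootPoly_elemSymm, eval_prod, eval_sub, eval_X, eval_C, Pi.zero_apply, mul_zero,
    zero_mul, Finset.sum_const_zero] at h4
  have h5 : HasDerivAt (fun s : ℝ => ∏ i, (x k - (x + s • v) i))
      (-v k * ∏ i ∈ Finset.univ.erase k, (x k - x i)) 0 := by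
    have h6 (i : Fin n) : HasDerivAt (fun s : ℝ => x k - (x + s • v) i) (-v i) 0 :=
      ((hasDerivAt_pi.mp hline) i).const_sub (x k)
    have h7 := HasDerivAt.fun_finsetProd (u := Finset.univ) fun i _ => h6 i
    convert! h7 using 1
    rw [Finset.sum_eq_single k]
    · simp [mul_comm]
    · intro i _ hik
      rw [Finset.prod_eq_zero (Finset.mem_erase.mpr ⟨hik.symm, Finset.mem_univ k⟩) (by simp),
        zero_smul]
    · simp
  have h8 := h5.unique h4
  rcases mul_eq_zero.mp h8 with h | h
  · simpa using h
  · obtain ⟨i, hi, h⟩ := Finset.prod_eq_zero_iff.mp h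
    exact absurd (hx (sub_eq_zero.mp h)).symm (Finset.mem_erase.mp hi).1

/-- A germ of an analytic function at `σ(a)` is determined by its composition with `σ`. -/
theorem eventuallyEq_of_comp_elemSymm {n : ℕ} {a : Fin n → ℝ} {g h : (Fin n → ℝ) → ℝ}
    (hg : AnalyticAt ℝ g (elemSymm n a)) (hh : AnalyticAt ℝ h (elemSymm n a))
    (hgh : ∀ᶠ x in 𝓝 a, g (elemSymm n x) = h (elemSymm n x)) :
    g =ᶠ[𝓝 (elemSymm n a)] h := by
  obtain ⟨r, hr, hB⟩ := Metric.eventually_nhds_iff_ball.mp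
    (hg.eventually_analyticAt.and hh.eventually_analyticAt)
  have h1 : ∀ᶠ x in 𝓝 a, elemSymm n x ∈ Metric.ball (elemSymm n a) r :=
    (continuous_elemSymm n).continuousAt.eventually (Metric.ball_mem_nhds _ hr)
  -- σ may degenerate at a, so openness is used at a nearby x with distinct entries; the identity
  -- theorem on the ball carries the equality back to σ(a).
  obtain ⟨x, hx, hxB, hxe⟩ := ((frequently_injective a).and_eventually
    (h1.and hgh.eventually_nhds)).exists
  have h2 : g =ᶠ[𝓝 (elemSymm n x)] h := by
    rw [← map_nhds_elemSymm hx]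
    exact hxe
  have h3 := AnalyticOnNhd.eqOn_of_preconnected_of_eventuallyEq (fun y hy => (hB y hy).1)
    (fun y hy => (hB y hy).2) (convex_ball _ _).isPreconnected hxB h2
  exact h3.eventuallyEq_of_mem (Metric.ball_mem_nhds _ hr)

end

/-! ### Cauchy's formula on the unit polydisc. -/

noncomputable section

open Finset MeasureTheory AddCircle

theorem integral_fourier_eq_ite (m : ℤ) :
    ∫ t : UnitAddCircle, fourier m t ∂haarAddCircle = if m = 0 then (1 : ℂ) else 0 := by
  split_ifs with h
  · simp [h]
  · exact integral_eq_zero_of_add_right_eq_neg (μ := haarAddCircle)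
      (fourier_add_half_inv_index h one_pos)

theorem norm_fourier_apply (m : ℤ) (t : UnitAddCircle) : ‖(fourier m t : ℂ)‖ = 1 := by
  rw [fourier_apply, Circle.norm_coe]

theorem fourier_one_sub_ne_zero {w : ℂ} (hw : ‖w‖ ≠ 1) (t : UnitAddCircle) :
    (fourier 1 t : ℂ) - w ≠ 0 := by
  intro h
  apply hw
  rw [← sub_eq_zero.mp h, norm_fourier_apply]

/-- The mean value over the unit circle of `u ^ m * (u / (u - w))`. -/
def circleMean (w : ℂ) (m : ℤ) : ℂ :=
  ∫ t : UnitAddCircle, fourier m t * (fourier 1 t / (fourier 1 t - w)) ∂haarAddCircle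

theorem continuous_circleMean_integrand {w : ℂ} (hw : ‖w‖ ≠ 1) (m : ℤ) :
    Continuous fun t : UnitAddCircle =>
      (fourier m t * (fourier 1 t / (fourier 1 t - w)) : ℂ) := by
  have h1 : Continuous fun t : UnitAddCircle => (fourier 1 t : ℂ) := (fourier 1).continuous
  exact (fourier m).continuous.mul (h1.div (h1.sub continuous_const) (fourier_one_sub_ne_zero hw))

/-- Integrate u^{m+1} · u/(u-w) = u^{m+1} + w u^m · u/(u-w). With boundedness in m, this recurrence
determines the means without contour integration. -/
theorem circleMean_succ {w : ℂ} (hw : ‖w‖ ≠ 1) (m : ℤ) :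
    circleMean w (m + 1) = (if m + 1 = 0 then 1 else 0) + w * circleMean w m := by
  have hint {f : UnitAddCircle → ℂ} (hf : Continuous f) : Integrable f haarAddCircle :=
    hf.integrable_of_hasCompactSupport (HasCompactSupport.of_compactSpace f)
  rw [← integral_fourier_eq_ite, circleMean, circleMean, ← integral_const_mul]
  refine Eq.trans ?_ (integral_add (hint (fourier (m + 1)).continuous)
    (hint (continuous_const.mul (continuous_circleMean_integrand hw m))))
  refine integral_congr_ae (Eventually.of_forall fun t => ?_)
  have h := fourier_one_sub_ne_zero hw t
  simp only [fourier_add]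
  field_simp
  ring

theorem exists_norm_circleMean_le {w : ℂ} (hw : ‖w‖ ≠ 1) :
    ∃ C : ℝ, ∀ m, ‖circleMean w m‖ ≤ C := by
  obtain ⟨C, hC⟩ := isCompact_univ.exists_bound_of_continuousOn
    (continuous_circleMean_integrand hw 0).continuousOn
  refine ⟨C, fun m => ?_⟩
  refine (norm_integral_le_of_norm_le_const (C := C) (Eventually.of_forall fun t => ?_)).trans ?_
  · have := hC t (Set.mem_univ t)
    rwa [norm_mul, norm_fourier_apply] at this ⊢
  · simp

/-- For m ≥ 0 the recurrence only multiplies by w, so a nonzero value would grow without bound. -/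
theorem circleMean_eq_zero {w : ℂ} (hw : 1 < ‖w‖) (m : ℕ) : circleMean w m = 0 := by
  obtain ⟨C, hC⟩ := exists_norm_circleMean_le hw.ne'
  have h1 (k : ℕ) : circleMean w (m + k : ℕ) = w ^ k * circleMean w m := by
    induction k with
    | zero => simp
    | succ k ih =>
      have h2 := circleMean_succ hw.ne' ((m + k : ℕ) : ℤ)
      rw [if_neg (by positivity), zero_add, ih] at h2
      rw [pow_succ', mul_assoc, ← h2]
      congr 1
  by_contra hne
  have h2 : Tendsto (fun k : ℕ => ‖w‖ ^ k * ‖circleMean w m‖) atTop atTop :=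
    (tendsto_pow_atTop_atTop_of_one_lt hw).atTop_mul_const (norm_pos_iff.mpr hne)
  obtain ⟨k, hk⟩ := (h2.eventually_gt_atTop C).exists
  refine absurd (hC (m + k : ℕ)) (not_le.mpr ?_)
  rwa [h1, norm_mul, norm_pow]

theorem circleMean_eq_pow {w : ℂ} (hw : ‖w‖ < 1) (m : ℕ) : circleMean w m = w ^ m := by
  obtain ⟨C, hC⟩ := exists_norm_circleMean_le hw.ne
  -- Below index 0 the recurrence is again multiplication by w; running it downwards forces the
  -- value at -1 to vanish, and the step from -1 to 0 supplies w^0 = 1.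
  have h1 (k : ℕ) : circleMean w (-1) = w ^ k * circleMean w (-1 - k) := by
    induction k with
    | zero => simp
    | succ k ih =>
      have h2 := circleMean_succ hw.ne (-1 - (k + 1 : ℕ))
      rw [if_neg (by push_cast; omega), zero_add] at h2
      rw [ih, pow_succ, mul_assoc, ← h2]
      congr 2
      push_cast
      ring
  have h2 : circleMean w (-1) = 0 := by
    rw [← norm_le_zero_iff]
    have h3 : Tendsto (fun k : ℕ => ‖w‖ ^ k * C) atTop (𝓝 (0 * C)) :=
      (tendsto_pow_atTop_nhds_zero_of_lt_one (norm_nonneg w) hw).mul_const C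
    rw [zero_mul] at h3
    refine ge_of_tendsto' h3 fun k => ?_
    rw [h1 k, norm_mul, norm_pow]
    exact mul_le_mul_of_nonneg_left (hC _) (by positivity)
  induction m with
  | zero =>
    have h3 := circleMean_succ hw.ne (-1)
    rw [h2] at h3
    simpa using h3
  | succ m ih =>
    have h3 := circleMean_succ hw.ne (m : ℤ)
    rw [if_neg (by positivity), zero_add, ih] at h3
    rw [pow_succ', ← h3]
    rfl

/-- The distinguished boundary of the unit polydisc. -/
abbrev Torus (n : ℕ) : Type := Fin n → UnitAddCircle

/-- The mean value over the torus, as a continuous linear functional. -/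
def torusMean (n : ℕ) : C(Torus n, ℂ) →L[ℂ] ℂ :=
  LinearMap.mkContinuous
    { toFun := fun h => ∫ t, h t ∂(Measure.pi fun _ : Fin n => haarAddCircle (T := (1 : ℝ)))
      map_add' := fun f g => integral_add
        (f.continuous.integrable_of_hasCompactSupport (HasCompactSupport.of_compactSpace f))
        (g.continuous.integrable_of_hasCompactSupport (HasCompactSupport.of_compactSpace g))
      map_smul' := fun c f => integral_const_mul c f } 1 fun h => by
    refine (norm_integral_le_of_norm_le_const
      (Eventually.of_forall fun t => h.norm_coe_le_norm t)).trans ?_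
    simp

theorem torusMean_eq_prod {n : ℕ} (h : C(Torus n, ℂ)) (k : Fin n → UnitAddCircle → ℂ)
    (hk : ∀ t, h t = ∏ i, k i (t i)) :
    torusMean n h = ∏ i, ∫ s, k i s ∂haarAddCircle := by
  rw [← integral_fintype_prod_eq_prod]
  exact integral_congr_ae (Eventually.of_forall hk)

/-- The `i`-th coordinate function on the torus, with values in the unit circle. -/
def torusCoord {n : ℕ} (i : Fin n) : C(Torus n, ℂ) :=
  ⟨fun t => fourier 1 (t i), (fourier 1).continuous.comp (continuous_apply i)⟩

theorem ringInverse_apply {n : ℕ} {h : C(Torus n, ℂ)} (hh : ∀ t, h t ≠ 0) (t : Torus n) :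
    Ring.inverse h t = (h t)⁻¹ := by
  have h1 := Ring.mul_inverse_cancel h ((ContinuousMap.isUnit_iff_forall_ne_zero h).mpr hh)
  have h2 := congrArg (fun k : C(Torus n, ℂ) => k t) h1
  exact eq_inv_of_mul_eq_one_right h2

/-- The Cauchy kernel at `v` of the unit polydisc. -/
def torusKernel {n : ℕ} (v : Fin n → ℂ) : C(Torus n, ℂ) :=
  ∏ i, torusCoord i * Ring.inverse (torusCoord i - algebraMap ℂ _ (v i))

theorem torusCoord_sub_ne_zero {n : ℕ} {w : ℂ} (hw : ‖w‖ ≠ 1) (i : Fin n) (t : Torus n) :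
    (torusCoord i - algebraMap ℂ C(Torus n, ℂ) w) t ≠ 0 :=
  fourier_one_sub_ne_zero hw (t i)

theorem torusMean_monomial_mul_torusKernel {n : ℕ} {v : Fin n → ℂ} (hv : ∀ i, ‖v i‖ ≠ 1)
    (ν : Fin n →₀ ℕ) :
    torusMean n ((∏ i, torusCoord i ^ ν i) * torusKernel v) =
      if ∀ i, ‖v i‖ < 1 then ∏ i, v i ^ ν i else 0 := by
  have hpow (m : ℕ) (s : UnitAddCircle) : (fourier 1 s : ℂ) ^ m = fourier m s := by
    rw [fourier_apply, fourier_apply, one_zsmul, natCast_zsmul, toCircle_nsmul, Circle.coe_pow]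
  have h1 : torusMean n ((∏ i, torusCoord i ^ ν i) * torusKernel v) =
      ∏ i, circleMean (v i) (ν i) := by
    refine torusMean_eq_prod _ _ fun t => ?_
    rw [torusKernel, ← Finset.prod_mul_distrib, ContinuousMap.prod_apply]
    refine Finset.prod_congr rfl fun i _ => ?_
    simp only [ContinuousMap.mul_apply, ContinuousMap.pow_apply,
      ringInverse_apply (torusCoord_sub_ne_zero (hv i) i), div_eq_mul_inv, ← hpow]
    rfl
  rw [h1]
  split_ifs with h
  · exact Finset.prod_congr rfl fun i _ => circleMean_eq_pow (h i) _
  · obtain ⟨i, hi⟩ := not_forall.mp h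
    exact Finset.prod_eq_zero (Finset.mem_univ i)
      (circleMean_eq_zero (lt_of_le_of_ne (not_lt.mp hi) (hv i).symm) _)

/-- Cauchy's formula on the unit polydisc for the product of an absolutely convergent power series
and a polynomial. -/
theorem torusMean_mul_torusKernel {n : ℕ} {v : Fin n → ℂ} (hv : ∀ i, ‖v i‖ ≠ 1)
    {c : (Fin n →₀ ℕ) → ℂ} {F : C(Torus n, ℂ)} {s : ℂ}
    (hF : HasSum (fun ν => c ν • ∏ i, torusCoord i ^ ν i) F)
    (hs : (∀ i, ‖v i‖ < 1) → HasSum (fun ν => c ν * ∏ i, v i ^ ν i) s)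
    (p : MvPolynomial (Fin n) ℂ) :
    torusMean n (F * MvPolynomial.aeval torusCoord p * torusKernel v) =
      if ∀ i, ‖v i‖ < 1 then s * MvPolynomial.aeval v p else 0 := by
  have hmon (ν : Fin n →₀ ℕ) :
      torusMean n ((∏ i, torusCoord i ^ ν i) * (MvPolynomial.aeval torusCoord p * torusKernel v)) =
      if ∀ i, ‖v i‖ < 1 then (∏ i, v i ^ ν i) * MvPolynomial.aeval v p else 0 := by
    induction p using MvPolynomial.induction_on' with
    | monomial μ r =>
      rw [MvPolynomial.aeval_monomial, MvPolynomial.aeval_monomial,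
        Finsupp.prod_fintype _ _ (by simp), Finsupp.prod_fintype _ _ (by simp)]
      have h1 := torusMean_monomial_mul_torusKernel hv (ν + μ)
      simp only [Finsupp.add_apply, pow_add, Finset.prod_mul_distrib] at h1
      rw [show (∏ i, torusCoord i ^ ν i) * ((algebraMap ℂ C(Torus n, ℂ)) r *
          (∏ i, torusCoord i ^ μ i) * torusKernel v) = r • ((∏ i, torusCoord i ^ ν i) *
          (∏ i, torusCoord i ^ μ i) * torusKernel v) by ext t; simp; ring,
        map_smul, h1, smul_ite, smul_zero, smul_eq_mul, Algebra.algebraMap_self_apply]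
      congr 1
      ring
    | add p q hp hq =>
      rw [map_add, add_mul, mul_add, map_add, hp, hq]
      split_ifs
      · rw [map_add]; ring
      · simp
  have h1 := (hF.mul_right (MvPolynomial.aeval torusCoord p * torusKernel v)).mapL (torusMean n)
  simp only [smul_mul_assoc, map_smul, hmon] at h1
  split_ifs with h
  · simp only [if_pos h, smul_eq_mul, ← mul_assoc] at h1
    exact h1.unique ((hs h).mul_right _)
  · simp only [if_neg h, smul_zero] at h1
    rw [mul_assoc]
    exact h1.unique hasSum_zero

end

/-! ### The integral formula and local existence. -/

noncomputable section

open Finset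

/-- The `i`-th coordinate function on the torus of radius `ρ` around `a`. -/
def shiftedCoord {n : ℕ} (a : Fin n → ℝ) (ρ : ℝ) (i : Fin n) : C(Torus n, ℂ) :=
  algebraMap ℂ _ (a i : ℂ) + (ρ : ℂ) • torusCoord i

/-- The kernel `∏ᵢ (zᵢ - aᵢ) / P_y(zᵢ)` on the torus of radius `ρ` around `a`, where `P_y` is the
monic polynomial with coefficients `y`. -/
def rootKernel {n : ℕ} (a : Fin n → ℝ) (ρ : ℝ) (y : Fin n → ℝ) : C(Torus n, ℂ) :=
  ∏ i, ((ρ : ℂ) • torusCoord i) *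
    Ring.inverse (Polynomial.aeval (shiftedCoord a ρ i) (rootPoly y))

/-- The polynomial `∏_{i ≠ j} (zᵢ - zⱼ)` in terms of the coordinates `(zᵢ - aᵢ) / ρ`. -/
def rootDifferences {n : ℕ} (a : Fin n → ℝ) (ρ : ℝ) : MvPolynomial (Fin n) ℂ :=
  ∏ i, ∏ j ∈ Finset.univ.erase i, (MvPolynomial.C ((a i - a j : ℝ) : ℂ) +
    MvPolynomial.C (ρ : ℂ) * (MvPolynomial.X i - MvPolynomial.X j))

theorem aeval_rootDifferences {n : ℕ} {a : Fin n → ℝ} {ρ : ℝ} (hρ : ρ ≠ 0) (x : Fin n → ℝ) :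
    MvPolynomial.aeval (fun i => (((x i - a i) / ρ : ℝ) : ℂ)) (rootDifferences a ρ) =
      ∏ i, ∏ j ∈ Finset.univ.erase i, ((x i : ℂ) - x j) := by
  simp only [rootDifferences, map_prod]
  refine Finset.prod_congr rfl fun i _ => Finset.prod_congr rfl fun j _ => ?_
  have hρ' : (ρ : ℂ) ≠ 0 := by exact_mod_cast hρ
  simp only [map_add, map_mul, map_sub, MvPolynomial.aeval_X, MvPolynomial.algHom_C,
    Algebra.algebraMap_self_apply]
  push_cast
  field_simp
  ring

theorem aeval_shiftedCoord_rootPoly_apply {n : ℕ} (a : Fin n → ℝ) (ρ : ℝ) (x : Fin n → ℝ)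
    (i : Fin n) (t : Torus n) :
    (Polynomial.aeval (shiftedCoord a ρ i) (rootPoly (elemSymm n x))) t =
      ∏ j, (shiftedCoord a ρ i t - x j) := by
  rw [rootPoly_elemSymm, map_prod, ContinuousMap.prod_apply]
  refine Finset.prod_congr rfl fun j _ => ?_
  rw [map_sub, Polynomial.aeval_X, Polynomial.aeval_C]
  rfl

theorem shiftedCoord_apply_sub {n : ℕ} {a : Fin n → ℝ} {ρ : ℝ} (hρ : ρ ≠ 0) (i : Fin n)
    (b : ℝ) (t : Torus n) :
    shiftedCoord a ρ i t - b = ρ * (torusCoord i t - ((b - a i) / ρ : ℝ)) := by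
  have hρ' : (ρ : ℂ) ≠ 0 := by exact_mod_cast hρ
  have h : shiftedCoord a ρ i t = a i + ρ * torusCoord i t := rfl
  rw [h]
  push_cast
  field_simp
  ring

theorem shiftedCoord_apply_sub_ne_zero {n : ℕ} {a : Fin n → ℝ} {ρ : ℝ} (hρ : ρ ≠ 0) {i : Fin n}
    {b : ℝ} (hb : |(b - a i) / ρ| ≠ 1) (t : Torus n) : shiftedCoord a ρ i t - b ≠ 0 := by
  rw [shiftedCoord_apply_sub hρ]
  have hb' : ‖(((b - a i) / ρ : ℝ) : ℂ)‖ ≠ 1 := by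
    rwa [Complex.norm_real, Real.norm_eq_abs]
  exact mul_ne_zero (by exact_mod_cast hρ) (torusCoord_sub_ne_zero hb' i t)

/-- The reciprocal `1 / P'(x_k)` of the derivative at a root of `P = ∏ (X - x_j)`. -/
def rootWeight {n : ℕ} (x : Fin n → ℝ) (k : Fin n) : ℂ :=
  Lagrange.nodalWeight Finset.univ (fun j => (x j : ℂ)) k

/-- Partial fractions of 1/∏ (z - x_k), read off from Lagrange interpolation of the constant 1 at
the distinct nodes x_k. -/
theorem rootKernel_factor_eq_sum {n : ℕ} {a : Fin n → ℝ} {ρ : ℝ} (hρ : ρ ≠ 0) {x : Fin n → ℝ}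
    (hx : Function.Injective x) {i : Fin n} (hv : ∀ k, |(x k - a i) / ρ| ≠ 1) :
    ((ρ : ℂ) • torusCoord i) *
      Ring.inverse (Polynomial.aeval (shiftedCoord a ρ i) (rootPoly (elemSymm n x))) =
    ∑ k, rootWeight x k • (torusCoord i *
      Ring.inverse (torusCoord i - algebraMap ℂ C(Torus n, ℂ) ((x k - a i) / ρ : ℝ))) := by
  ext t
  have hz (k : Fin n) : shiftedCoord a ρ i t - x k ≠ 0 := shiftedCoord_apply_sub_ne_zero hρ (hv k) t
  have hne (t : Torus n) :
      (Polynomial.aeval (shiftedCoord a ρ i) (rootPoly (elemSymm n x))) t ≠ 0 := by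
    rw [aeval_shiftedCoord_rootPoly_apply]
    exact Finset.prod_ne_zero_iff.mpr fun k _ => shiftedCoord_apply_sub_ne_zero hρ (hv k) t
  have hv' (k : Fin n) : ‖(((x k - a i) / ρ : ℝ) : ℂ)‖ ≠ 1 := by
    rw [Complex.norm_real, Real.norm_eq_abs]
    exact hv k
  have hinj : Set.InjOn (fun j => (x j : ℂ)) (Finset.univ : Finset (Fin n)) :=
    fun j _ k _ h => hx (Complex.ofReal_injective h)
  have hL := Lagrange.eval_interpolate_not_at_node (s := Finset.univ) (v := fun j => (x j : ℂ))
    (x := shiftedCoord a ρ i t) 1 fun k _ => sub_ne_zero.mp (hz k)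
  rw [Lagrange.interpolate_one hinj ⟨i, Finset.mem_univ i⟩, Polynomial.eval_one,
    Lagrange.eval_nodal] at hL
  have hL' : (∏ j, (shiftedCoord a ρ i t - x j))⁻¹ =
      ∑ k, rootWeight x k * (shiftedCoord a ρ i t - x k)⁻¹ := by
    refine inv_eq_of_mul_eq_one_right ?_
    simpa only [Pi.one_apply, mul_one] using! hL.symm
  rw [ContinuousMap.mul_apply, ringInverse_apply hne, aeval_shiftedCoord_rootPoly_apply, hL',
    ContinuousMap.sum_apply, Finset.mul_sum]
  refine Finset.sum_congr rfl fun k _ => ?_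
  have hρ' : (ρ : ℂ) ≠ 0 := by exact_mod_cast hρ
  change (ρ : ℂ) * torusCoord i t * _ = rootWeight x k * (torusCoord i t *
    Ring.inverse (torusCoord i - algebraMap ℂ C(Torus n, ℂ) ((x k - a i) / ρ : ℝ)) t)
  rw [ringInverse_apply (torusCoord_sub_ne_zero (hv' k) i), shiftedCoord_apply_sub hρ]
  change (ρ : ℂ) * torusCoord i t * (rootWeight x k * (ρ * (torusCoord i t - _))⁻¹) =
    rootWeight x k * (torusCoord i t * (torusCoord i t - _)⁻¹)
  rw [mul_inv]
  field_simp
  rfl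

theorem rootKernel_elemSymm {n : ℕ} {a : Fin n → ℝ} {ρ : ℝ} (hρ : ρ ≠ 0) {x : Fin n → ℝ}
    (hx : Function.Injective x) (hv : ∀ i k, |(x k - a i) / ρ| ≠ 1) :
    rootKernel a ρ (elemSymm n x) = ∑ κ : Fin n → Fin n, (∏ i, rootWeight x (κ i)) •
      torusKernel fun i => (((x (κ i) - a i) / ρ : ℝ) : ℂ) := by
  rw [rootKernel, Finset.prod_congr rfl fun i _ => rootKernel_factor_eq_sum hρ hx (hv i),
    Finset.prod_univ_sum]
  simp only [Fintype.piFinset_univ]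
  refine Finset.sum_congr rfl fun κ _ => ?_
  rw [torusKernel, Finset.prod_smul]

/-- P_y(z_i) is affine in y with values in the Banach algebra of continuous functions on the torus,
where inversion is analytic at units; no differentiation under the integral is needed. -/
theorem analyticAt_rootKernel {n : ℕ} {a : Fin n → ℝ} {ρ : ℝ} {y : Fin n → ℝ}
    (h : ∀ i t, (Polynomial.aeval (shiftedCoord a ρ i) (rootPoly y)) t ≠ 0) :
    AnalyticAt ℝ (rootKernel a ρ) y := by
  refine Finset.analyticAt_fun_prod _ fun i _ => analyticAt_const.mul ?_
  have h1 : AnalyticAt ℝ (fun y : Fin n → ℝ =>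
      Polynomial.aeval (shiftedCoord a ρ i) (rootPoly y)) y := by
    have h2 (y : Fin n → ℝ) : Polynomial.aeval (shiftedCoord a ρ i) (rootPoly y) =
        shiftedCoord a ρ i ^ n + ∑ k : Fin n,
          ((-1) ^ ((k : ℕ) + 1) * y k) • shiftedCoord a ρ i ^ (n - ((k : ℕ) + 1)) := by
      rw [rootPoly, map_add, map_pow, Polynomial.aeval_X, map_sum]
      congr 1
      refine Finset.sum_congr rfl fun k _ => ?_
      rw [map_mul, Polynomial.aeval_C, map_pow, Polynomial.aeval_X]
      ext t
      exact Complex.real_smul.symm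
    simp only [h2]
    refine analyticAt_const.add (Finset.analyticAt_fun_sum _ fun k _ => ?_)
    have h3 : AnalyticAt ℝ (fun y : Fin n → ℝ => (-1) ^ ((k : ℕ) + 1) * y k) y :=
      analyticAt_const.mul
        ((ContinuousLinearMap.proj (R := ℝ) (φ := fun _ : Fin n => ℝ) k).analyticAt y)
    exact h3.smul analyticAt_const
  have h3 : AnalyticAt ℝ Ring.inverse (Polynomial.aeval (shiftedCoord a ρ i) (rootPoly y)) :=
    analyticOnNhd_inverse _ ((ContinuousMap.isUnit_iff_forall_ne_zero _).mpr (h i))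
  exact h3.comp_of_eq h1 rfl

/-- An injective κ is bijective, so the inner product over j is P'(x_{κ(i)}), the inverse of the
weight. -/
theorem prod_rootWeight_mul_prod_sub {n : ℕ} {x : Fin n → ℝ} (hx : Function.Injective x)
    {κ : Fin n → Fin n} (hκ : Function.Injective κ) :
    (∏ i, rootWeight x (κ i)) * ∏ i, ∏ j ∈ Finset.univ.erase i, ((x (κ i) : ℂ) - x (κ j)) = 1 := by
  rw [← Finset.prod_mul_distrib]
  refine Finset.prod_eq_one fun i _ => ?_
  have h : ∏ j ∈ Finset.univ.erase i, ((x (κ i) : ℂ) - x (κ j)) =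
      ∏ l ∈ Finset.univ.erase (κ i), ((x (κ i) : ℂ) - x l) := by
    refine Finset.prod_nbij κ (fun j hj => ?_) hκ.injOn (fun l hl => ?_) fun _ _ => rfl
    · exact Finset.mem_erase.mpr ⟨fun h => (Finset.mem_erase.mp hj).1 (hκ h), Finset.mem_univ _⟩
    · obtain ⟨j, rfl⟩ := (Finite.injective_iff_surjective.mp hκ) l
      refine ⟨j, Finset.mem_coe.mpr (Finset.mem_erase.mpr ⟨?_, Finset.mem_univ _⟩), rfl⟩
      rintro rfl
      exact (Finset.mem_erase.mp (Finset.mem_coe.mp hl)).1 rfl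
  rw [h, rootWeight, Lagrange.nodalWeight, ← Finset.prod_mul_distrib]
  refine Finset.prod_eq_one fun l hl => inv_mul_cancel₀ (sub_ne_zero.mpr fun h => ?_)
  exact (Finset.mem_erase.mp hl).1 (hx (Complex.ofReal_injective h)).symm

theorem prod_sub_eq_zero {n : ℕ} (x : Fin n → ℝ) {κ : Fin n → Fin n}
    (hκ : ¬ Function.Injective κ) :
    ∏ i, ∏ j ∈ Finset.univ.erase i, ((x (κ i) : ℂ) - x (κ j)) = 0 := by
  obtain ⟨i, j, hij, hne⟩ := Function.not_injective_iff.mp hκ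
  refine Finset.prod_eq_zero (Finset.mem_univ i) (Finset.prod_eq_zero
    (Finset.mem_erase.mpr ⟨hne.symm, Finset.mem_univ j⟩) ?_)
  rw [hij, sub_self]

/-- The radius `ρ` separates the distinct entries of `a`. -/
def SeparatesEntries {n : ℕ} (a : Fin n → ℝ) (ρ : ℝ) : Prop :=
  ∀ i j, a i ≠ a j → 2 * ρ ≤ |a i - a j|

theorem eventually_separatesEntries {n : ℕ} (a : Fin n → ℝ) :
    ∀ᶠ ρ in 𝓝[>] (0 : ℝ), SeparatesEntries a ρ := by
  simp only [SeparatesEntries, eventually_all]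
  intro i j hij
  have h : ∀ᶠ ρ in 𝓝 (0 : ℝ), ρ < |a i - a j| / 2 :=
    eventually_lt_nhds (by have := abs_pos.mpr (sub_ne_zero.mpr hij); linarith)
  filter_upwards [nhdsWithin_le_nhds h] with ρ hρ
  linarith

/-- The root x_k never lies on the circle around a_i, and lies inside it exactly when a_k = a_i;
thus Cauchy's formula selects the stabilizer of a. -/
theorem abs_div_lt_one_iff_of_separatesEntries {n : ℕ} {a x : Fin n → ℝ} {ρ : ℝ} (hρ : 0 < ρ)
    (hsep : SeparatesEntries a ρ) (hx : ‖x - a‖ < ρ) (i k : Fin n) :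
    |(x k - a i) / ρ| ≠ 1 ∧ (|(x k - a i) / ρ| < 1 ↔ a k = a i) := by
  have h1 : |x k - a k| < ρ := (norm_le_pi_norm (x - a) k).trans_lt hx
  rw [abs_div, abs_of_pos hρ, Ne, div_eq_one_iff_eq hρ.ne', div_lt_one hρ]
  by_cases h : a k = a i
  · rw [← h]
    exact ⟨h1.ne, iff_of_true h1 rfl⟩
  · have h2 := hsep k i h
    have h3 : |a k - a i| ≤ |x k - a i| + |x k - a k| := by
      calc |a k - a i| = |(x k - a i) - (x k - a k)| := by congr 1; ring
        _ ≤ _ := abs_sub _ _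
    exact ⟨by intro h4; linarith, iff_of_false (by intro h4; linarith) h⟩

theorem norm_prod_torusCoord_pow_le {n : ℕ} (ν : Fin n →₀ ℕ) :
    ‖∏ i, (torusCoord i : C(Torus n, ℂ)) ^ ν i‖ ≤ 1 := by
  refine (ContinuousMap.norm_le _ zero_le_one).mpr fun t => ?_
  rw [ContinuousMap.prod_apply, norm_prod]
  refine Finset.prod_le_one (fun _ _ => norm_nonneg _) fun i _ => ?_
  rw [ContinuousMap.pow_apply, norm_pow]
  exact pow_le_one₀ (norm_nonneg _) (norm_fourier_apply 1 (t i)).le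

theorem exists_hasSum_torus {n : ℕ} {c : (Fin n →₀ ℕ) → ℝ} {ρ : ℝ} (hρ : 0 ≤ ρ)
    (hc : Summable fun ν => |c ν| * ρ ^ multiDegree ν) : ∃ F : C(Torus n, ℂ),
      HasSum (fun ν => ((c ν * ρ ^ multiDegree ν : ℝ) : ℂ) • ∏ i, torusCoord i ^ ν i) F := by
  refine ⟨_, (Summable.of_norm_bounded hc fun ν => ?_).hasSum⟩
  refine (norm_smul_le (_ : ℂ) (_ : C(Torus n, ℂ))).trans ?_
  rw [Complex.norm_real, norm_mul, norm_pow, Real.norm_eq_abs, Real.norm_of_nonneg hρ]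
  exact mul_le_of_le_one_right (by positivity) (norm_prod_torusCoord_pow_le ν)

theorem norm_comp_sub_le {n : ℕ} {a x : Fin n → ℝ} {κ : Fin n → Fin n}
    (hκa : ∀ i, a (κ i) = a i) : ‖(fun i => x (κ i)) - a‖ ≤ ‖x - a‖ := by
  refine (pi_norm_le_iff_of_nonneg (norm_nonneg _)).mpr fun i => ?_
  have := norm_le_pi_norm (x - a) (κ i)
  simpa only [Pi.sub_apply, hκa] using this

/-- The integral formula for a function which is symmetric under the stabilizer of `a`. -/
theorem torusMean_mul_rootKernel {n : ℕ} {a : Fin n → ℝ} {ρ : ℝ} (hρ : 0 < ρ)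
    (hsep : SeparatesEntries a ρ) {f : (Fin n → ℝ) → ℝ} {c : (Fin n →₀ ℕ) → ℝ}
    {F : C(Torus n, ℂ)}
    (hF : HasSum (fun ν => ((c ν * ρ ^ multiDegree ν : ℝ) : ℂ) • ∏ i, torusCoord i ^ ν i) F)
    (hf : ∀ x : Fin n → ℝ, ‖x‖ ≤ ρ → HasSum (fun ν => c ν * ∏ i, x i ^ ν i) (f (a + x)))
    (hsymm : ∀ κ : Fin n → Fin n, Function.Injective κ → (∀ i, a (κ i) = a i) →
      ∀ x, ‖x - a‖ < ρ → f (fun i => x (κ i)) = f x)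
    {x : Fin n → ℝ} (hx : Function.Injective x) (hxa : ‖x - a‖ < ρ) :
    torusMean n (F * MvPolynomial.aeval torusCoord (rootDifferences a ρ) *
      rootKernel a ρ (elemSymm n x)) =
      Nat.card {κ : Fin n → Fin n // Function.Injective κ ∧ ∀ i, a (κ i) = a i} * (f x : ℂ) := by
  classical
  have hv := abs_div_lt_one_iff_of_separatesEntries hρ hsep hxa
  rw [rootKernel_elemSymm hρ.ne' hx fun i k => (hv i k).1, Finset.mul_sum, map_sum]
  have hterm (κ : Fin n → Fin n) :
      torusMean n (F * MvPolynomial.aeval torusCoord (rootDifferences a ρ) *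
        ((∏ i, rootWeight x (κ i)) • torusKernel fun i => (((x (κ i) - a i) / ρ : ℝ) : ℂ))) =
      if Function.Injective κ ∧ ∀ i, a (κ i) = a i then (f x : ℂ) else 0 := by
    have hiff : (∀ i, ‖(((x (κ i) - a i) / ρ : ℝ) : ℂ)‖ < 1) ↔ ∀ i, a (κ i) = a i := by
      refine forall_congr' fun i => ?_
      rw [Complex.norm_real, Real.norm_eq_abs]
      exact (hv i (κ i)).2
    have hs : (∀ i, ‖(((x (κ i) - a i) / ρ : ℝ) : ℂ)‖ < 1) →
        HasSum (fun ν : Fin n →₀ ℕ => ((c ν * ρ ^ multiDegree ν : ℝ) : ℂ) *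
          ∏ i, (((x (κ i) - a i) / ρ : ℝ) : ℂ) ^ ν i) (f fun i => x (κ i)) := by
      intro h
      have h1 := (norm_comp_sub_le (x := x) (hiff.mp h)).trans hxa.le
      have h2 := Complex.hasSum_ofReal.mpr (hf _ h1)
      rw [add_sub_cancel] at h2
      refine h2.congr_fun fun ν => ?_
      have h3 : c ν * ρ ^ multiDegree ν * ∏ i, ((x (κ i) - a i) / ρ) ^ ν i =
          c ν * ∏ i, (x (κ i) - a i) ^ ν i := by
        rw [← prod_const_pow_eq, mul_assoc, ← Finset.prod_mul_distrib]
        simp only [← mul_pow, mul_div_cancel₀ _ hρ.ne']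
      simp only [Pi.sub_apply, ← h3]
      push_cast
      rfl
    rw [mul_smul_comm, map_smul, torusMean_mul_torusKernel (fun i => ?_) hF hs, smul_eq_mul]
    · simp only [hiff]
      by_cases h1 : ∀ i, a (κ i) = a i
      · rw [if_pos h1, aeval_rootDifferences hρ.ne' fun i => x (κ i)]
        by_cases h2 : Function.Injective κ
        · rw [if_pos ⟨h2, h1⟩, hsymm κ h2 h1 x hxa, mul_left_comm,
            prod_rootWeight_mul_prod_sub hx h2, mul_one]
        · rw [if_neg fun h => h2 h.1, prod_sub_eq_zero x h2, mul_zero, mul_zero]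
      · rw [if_neg h1, if_neg fun h => h1 h.2, mul_zero]
    · rw [Complex.norm_real, Real.norm_eq_abs]
      exact (hv i (κ i)).1
  rw [Finset.sum_congr rfl fun κ _ => hterm κ, ← Finset.sum_filter, Finset.sum_const,
    nsmul_eq_mul, Nat.card_eq_fintype_card, Fintype.card_subtype]

/-- Local form of the symmetric function theorem: a function which is analytic at `a` and
symmetric under the stabilizer of `a` is an analytic function of `σ` near `a`. -/
theorem exists_analyticAt_comp_elemSymm {n : ℕ} {a : Fin n → ℝ} {f : (Fin n → ℝ) → ℝ}
    (hf : AnalyticAt ℝ f a)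
    (hsymm : ∀ π : Equiv.Perm (Fin n), (∀ i, a (π i) = a i) →
      ∀ᶠ x in 𝓝 a, f (fun i => x (π i)) = f x) :
    ∃ g : (Fin n → ℝ) → ℝ, AnalyticAt ℝ g (elemSymm n a) ∧
      ∀ᶠ x in 𝓝 a, f x = g (elemSymm n x) := by
  obtain ⟨ρ₀, hρ₀, c, hc, hfc⟩ := hf.exists_hasSum_monomials
  have hsymm' : ∀ᶠ x in 𝓝 a, ∀ π : Equiv.Perm (Fin n), (∀ i, a (π i) = a i) →
      f (fun i => x (π i)) = f x := by
    simpa only [eventually_all] using hsymm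
  obtain ⟨ρ₁, hρ₁, hball⟩ := Metric.eventually_nhds_iff_ball.mp hsymm'
  have hlt {r : ℝ} (hr : 0 < r) : ∀ᶠ ρ in 𝓝[>] (0 : ℝ), ρ < r :=
    nhdsWithin_le_nhds (eventually_lt_nhds hr)
  obtain ⟨ρ, ⟨⟨hsep, hρρ₀⟩, hρρ₁⟩, hρ⟩ := ((((eventually_separatesEntries a).and
    (hlt hρ₀)).and (hlt hρ₁)).and self_mem_nhdsWithin).exists
  have hρ : 0 < ρ := hρ
  have hcρ : Summable fun ν => |c ν| * ρ ^ multiDegree ν :=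
    Summable.of_nonneg_of_le (fun ν => by positivity) (fun ν =>
      mul_le_mul_of_nonneg_left (pow_le_pow_left₀ hρ.le hρρ₀.le _) (abs_nonneg _)) hc
  obtain ⟨F, hF⟩ := exists_hasSum_torus hρ.le hcρ
  have hstab : ∀ κ : Fin n → Fin n, Function.Injective κ → (∀ i, a (κ i) = a i) →
      ∀ x, ‖x - a‖ < ρ → f (fun i => x (κ i)) = f x := by
    intro κ hκ hκa x hx
    refine hball x ?_ (Equiv.ofBijective κ (Finite.injective_iff_bijective.mp hκ)) hκa
    rw [Metric.mem_ball, dist_eq_norm]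
    exact hx.trans hρρ₁
  have hformula {x : Fin n → ℝ} := torusMean_mul_rootKernel (x := x) hρ hsep hF
    (fun x hx => hfc x (hx.trans hρρ₀.le)) hstab
  set N : ℕ := Nat.card {κ : Fin n → Fin n // Function.Injective κ ∧ ∀ i, a (κ i) = a i}
  have hN : (N : ℝ) ≠ 0 := by
    have : Nonempty {κ : Fin n → Fin n // Function.Injective κ ∧ ∀ i, a (κ i) = a i} :=
      ⟨⟨id, Function.injective_id, fun _ => rfl⟩⟩
    exact_mod_cast Nat.card_pos.ne'
  let Λ : C(Torus n, ℂ) →L[ℝ] ℂ := (torusMean n).restrictScalars ℝ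
  let g : (Fin n → ℝ) → ℝ := fun y => (Λ (F * MvPolynomial.aeval torusCoord (rootDifferences a ρ) *
    rootKernel a ρ y)).re / N
  have hga : AnalyticAt ℝ g (elemSymm n a) := by
    have h1 : AnalyticAt ℝ (rootKernel a ρ) (elemSymm n a) := by
      refine analyticAt_rootKernel fun i t => ?_
      rw [aeval_shiftedCoord_rootPoly_apply]
      refine Finset.prod_ne_zero_iff.mpr fun k _ => ?_
      refine shiftedCoord_apply_sub_ne_zero hρ.ne' ?_ t
      exact (abs_div_lt_one_iff_of_separatesEntries hρ hsep (by simpa using hρ) i k).1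
    have h2 := (Λ.analyticAt _).comp ((analyticAt_const
      (v := F * MvPolynomial.aeval torusCoord (rootDifferences a ρ))).mul h1)
    exact ((Complex.reCLM.analyticAt _).comp h2).div analyticAt_const hN
  have hginj : ∀ᶠ x in 𝓝 a, Function.Injective x → f x = g (elemSymm n x) := by
    filter_upwards [Metric.ball_mem_nhds a hρ] with x hx hinj
    rw [Metric.mem_ball, dist_eq_norm] at hx
    have h1 : Λ (F * MvPolynomial.aeval torusCoord (rootDifferences a ρ) *
        rootKernel a ρ (elemSymm n x)) = N * (f x : ℂ) := hformula hinj hx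
    simp only [g]
    rw [h1, ← Complex.ofReal_natCast, ← Complex.ofReal_mul, Complex.ofReal_re,
      mul_div_cancel_left₀ _ hN]
  refine ⟨g, hga, ?_⟩
  -- Extension to repeated entries: by continuity a nonzero value of f - g∘σ would persist at nearby
  -- points with distinct entries, where it vanishes.
  have hcont : ∀ᶠ x in 𝓝 a, AnalyticAt ℝ (fun x => f x - g (elemSymm n x)) x :=
    (hf.sub (hga.comp (analyticAt_elemSymm a))).eventually_analyticAt
  filter_upwards [hcont, hginj.eventually_nhds] with x hxc hxe
  by_contra hne
  have h1 := hxc.continuousAt.eventually_ne (sub_ne_zero.mpr hne)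
  obtain ⟨x', hinj, h2, h3⟩ := ((frequently_injective x).and_eventually (h1.and hxe)).exists
  exact h2 (sub_eq_zero.mpr (h3 hinj))

/-! ### Gluing the local solutions along σ(V). -/

/-- When the half-balls meet, the larger full ball contains the other centre t. The germs agree
there, and the identity theorem applies on the convex intersection of the full balls. -/
theorem eq_of_mem_halfBalls {E : Type*} [NormedAddCommGroup E] [NormedSpace ℝ E]
    {g h : E → ℝ} {s t y : E} {r r' : ℝ} (hr : r' ≤ r)
    (hg : AnalyticOnNhd ℝ g (Metric.ball s r)) (hh : AnalyticOnNhd ℝ h (Metric.ball t r'))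
    (hys : y ∈ Metric.ball s (r / 2)) (hyt : y ∈ Metric.ball t (r' / 2))
    (hgh : t ∈ Metric.ball s r → g =ᶠ[𝓝 t] h) : g y = h y := by
  rw [Metric.mem_ball] at hys hyt
  have hr' : 0 < r' := by linarith [dist_nonneg (x := y) (y := t)]
  have hts : t ∈ Metric.ball s r := by
    rw [Metric.mem_ball]
    have := dist_triangle_left t s y
    linarith
  refine AnalyticOnNhd.eqOn_of_preconnected_of_eventuallyEq
    (U := Metric.ball s r ∩ Metric.ball t r') (hg.mono Set.inter_subset_left)
    (hh.mono Set.inter_subset_right) ((convex_ball s r).inter (convex_ball t r')).isPreconnected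
    ⟨hts, Metric.mem_ball_self hr'⟩ (hgh hts) ⟨?_, ?_⟩
  · rw [Metric.mem_ball]; linarith [dist_nonneg (x := y) (y := s)]
  · rw [Metric.mem_ball]; linarith

/-- Analytic functions on balls centred at the points of a set `S` whose germs agree at the points
of `S` can be glued to a function near `S`. -/
theorem exists_eventuallyEq_of_compatible_germs {E : Type*} [NormedAddCommGroup E]
    [NormedSpace ℝ E] {S : Set E} {G : E → E → ℝ} {r : E → ℝ} (hr : ∀ s ∈ S, 0 < r s)
    (hG : ∀ s ∈ S, AnalyticOnNhd ℝ (G s) (Metric.ball s (r s)))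
    (hcompat : ∀ s ∈ S, ∀ t ∈ S, t ∈ Metric.ball s (r s) → G s =ᶠ[𝓝 t] G t) :
    ∃ g : E → ℝ, ∀ s ∈ S, g =ᶠ[𝓝 s] G s := by
  classical
  have hagree {s t y : E} (hs : s ∈ S) (ht : t ∈ S) (hys : y ∈ Metric.ball s (r s / 2))
      (hyt : y ∈ Metric.ball t (r t / 2)) : G s y = G t y := by
    rcases le_total (r t) (r s) with h | h
    · exact eq_of_mem_halfBalls h (hG s hs) (hG t ht) hys hyt (hcompat s hs t ht)
    · exact (eq_of_mem_halfBalls h (hG t ht) (hG s hs) hyt hys (hcompat t ht s hs)).symm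
  refine ⟨fun y => if h : ∃ s ∈ S, y ∈ Metric.ball s (r s / 2) then G h.choose y else 0,
    fun s hs => ?_⟩
  filter_upwards [Metric.ball_mem_nhds s (half_pos (hr s hs))] with y hy
  have h : ∃ s ∈ S, y ∈ Metric.ball s (r s / 2) := ⟨s, hs, hy⟩
  rw [dif_pos h]
  exact hagree h.choose_spec.1 hs h.choose_spec.2 hy

/-- The representation must hold at every b in V lying over the ball, not just near a, for the germs
to be comparable. Some permutation of b is close to a, and symmetry transports the identity to b. -/
theorem exists_local_solution {n : ℕ} {V : Set (Fin n → ℝ)} (hV : IsOpen V)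
    {f : (Fin n → ℝ) → ℝ} (hf : AnalyticOnNhd ℝ f V)
    (hsymm : ∀ π : Equiv.Perm (Fin n), ∀ x ∈ V, (fun i => x (π i)) ∈ V →
      f (fun i => x (π i)) = f x) {a : Fin n → ℝ} (ha : a ∈ V) :
    ∃ (g : (Fin n → ℝ) → ℝ) (r : ℝ), 0 < r ∧
      AnalyticOnNhd ℝ g (Metric.ball (elemSymm n a) r) ∧
      ∀ b ∈ V, elemSymm n b ∈ Metric.ball (elemSymm n a) r →
        ∀ᶠ x in 𝓝 b, f x = g (elemSymm n x) := by
  obtain ⟨g, hg, hfg⟩ := exists_analyticAt_comp_elemSymm (hf a ha) fun π hπ => by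
    have h : Tendsto (fun (x : Fin n → ℝ) i => x (π i)) (𝓝 a) (𝓝 a) := by
      have := (continuous_perm_comp π).tendsto a
      rwa [show (fun i => a (π i)) = a from funext hπ] at this
    filter_upwards [hV.mem_nhds ha, h (hV.mem_nhds ha)] with x hx hxπ
    exact hsymm π x hx hxπ
  obtain ⟨N, hN, hNo, haN⟩ := eventually_nhds_iff.mp (hfg.and (hV.mem_nhds ha))
  obtain ⟨r, hr, hB⟩ := Metric.eventually_nhds_iff_ball.mp
    (hg.eventually_analyticAt.and (eventually_exists_perm_mem hNo haN))
  refine ⟨g, r, hr, fun y hy => (hB y hy).1, fun b hb hbr => ?_⟩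
  obtain ⟨π, hπ⟩ := (hB _ hbr).2 b rfl
  filter_upwards [hV.mem_nhds hb,
    (continuous_perm_comp π).continuousAt.preimage_mem_nhds (hNo.mem_nhds hπ)] with x hx hxN
  obtain ⟨h1, h2⟩ := hN _ hxN
  rw [← hsymm π x hx h2, h1, elemSymm_comp_perm]

theorem exists_analyticOnNhd_comp_elemSymm {n : ℕ} {V : Set (Fin n → ℝ)} (hV : IsOpen V)
    {f : (Fin n → ℝ) → ℝ} (hf : AnalyticOnNhd ℝ f V)
    (hsymm : ∀ π : Equiv.Perm (Fin n), ∀ x ∈ V, (fun i => x (π i)) ∈ V →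
      f (fun i => x (π i)) = f x) :
    ∃ g : (Fin n → ℝ) → ℝ, AnalyticOnNhd ℝ g (elemSymm n '' V) ∧
      ∀ x ∈ V, f x = g (elemSymm n x) := by
  have hloc : ∀ y ∈ elemSymm n '' V, ∃ (g : (Fin n → ℝ) → ℝ) (r : ℝ), 0 < r ∧
      AnalyticOnNhd ℝ g (Metric.ball y r) ∧
      ∀ b ∈ V, elemSymm n b ∈ Metric.ball y r → ∀ᶠ x in 𝓝 b, f x = g (elemSymm n x) := by
    rintro _ ⟨a, ha, rfl⟩
    exact exists_local_solution hV hf hsymm ha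
  choose! G r hr hG hfG using hloc
  obtain ⟨g, hg⟩ := exists_eventuallyEq_of_compatible_germs hr hG (by
    rintro s hs _ ⟨b, hb, rfl⟩ hbs
    have ht : elemSymm n b ∈ elemSymm n '' V := ⟨b, hb, rfl⟩
    have hself := Metric.mem_ball_self (x := elemSymm n b) (hr _ ht)
    refine eventuallyEq_of_comp_elemSymm (hG s hs _ hbs) (hG _ ht _ hself) ?_
    filter_upwards [hfG s hs b hb hbs, hfG _ ht b hb hself] with x h1 h2
    rw [← h1, h2])
  refine ⟨g, fun y hy => ?_, fun x hx => ?_⟩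
  · exact (hG y hy y (Metric.mem_ball_self (hr y hy))).congr (hg y hy).symm
  · have hy : elemSymm n x ∈ elemSymm n '' V := ⟨x, hx, rfl⟩
    rw [(hg _ hy).eq_of_nhds]
    exact (hfG _ hy x hx (Metric.mem_ball_self (hr _ hy))).self_of_nhds

/-! ### Power series of g ∘ σ, and the polynomial case. -/

theorem mem_multiIndicesOfWeight {n d : ℕ} {lam : Fin n →₀ ℕ} :
    lam ∈ multiIndicesOfWeight n d ↔ multiWeight lam = d :=
  (finite_multiWeight_eq n d).mem_toFinset

theorem hasSum_coeff_mul_prod_pow {n : ℕ} (p : MvPolynomial (Fin n) ℝ) (x : Fin n → ℝ) :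
    HasSum (fun ν => MvPolynomial.coeff ν p * ∏ i, x i ^ ν i) (MvPolynomial.eval x p) := by
  rw [MvPolynomial.eval_eq']
  refine hasSum_sum_of_ne_finset_zero fun ν hν => ?_
  rw [MvPolynomial.notMem_support_iff.mp hν, zero_mul]

theorem exists_powerSeries_comp_elemSymm {n : ℕ} {f g : (Fin n → ℝ) → ℝ} (hg : AnalyticAt ℝ g 0)
    (hfg : ∀ᶠ x in 𝓝 (0 : Fin n → ℝ), f x = g (elemSymm n x)) :
    ∃ a b : (Fin n →₀ ℕ) → ℝ, HasPowerSeriesAtZero f a ∧ HasPowerSeriesAtZero g b ∧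
      ∀ ν : Fin n →₀ ℕ,
        a ν = ∑ lam ∈ multiIndicesOfWeight n (multiDegree ν), faaDiBrunoCoeff ν lam * b lam := by
  obtain ⟨ρ, hρ, b, hb, hgb⟩ := hg.exists_hasSum_monomials
  simp only [zero_add] at hgb
  -- The coefficients of f are defined by the linear system; what remains is that they represent f.
  refine ⟨_, b, ?_, ?_, fun ν => rfl⟩
  · have hsmall {h : (Fin n → ℝ) → Fin n → ℝ} (hh : Continuous h) (h0 : h 0 = 0) :
        ∀ᶠ x in 𝓝 (0 : Fin n → ℝ), ‖elemSymm n (h x)‖ ≤ ρ := by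
      have h1 : Tendsto (fun x => ‖elemSymm n (h x)‖) (𝓝 0) (𝓝 0) := by
        have := (((continuous_elemSymm n).comp hh).norm).tendsto 0
        simpa [h0, elemSymm_zero] using this
      exact h1.eventually_le_const hρ
    -- Smallness of σ(x) gives the value of the series, smallness of σ(|x|) its absolute
    -- convergence.
    filter_upwards [hfg, hsmall continuous_id rfl,
      hsmall (h := fun x i => |x i|) (by fun_prop) (by funext i; simp)] with x hfx hx hxabs
    let H : (Fin n →₀ ℕ) × (Fin n →₀ ℕ) → ℝ := fun q =>
      b q.1 * (MvPolynomial.coeff q.2 (esymmPow q.1) * ∏ i, x i ^ q.2 i)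
    have hrow (lam : Fin n →₀ ℕ) :
        HasSum (fun ν => H (lam, ν)) (b lam * ∏ i, elemSymm n x i ^ lam i) := by
      rw [← eval_esymmPow]
      exact (hasSum_coeff_mul_prod_pow _ _).mul_left _
    have hrowabs (lam : Fin n →₀ ℕ) : HasSum (fun ν => ‖H (lam, ν)‖)
        (|b lam| * ∏ i, elemSymm n (fun i => |x i|) i ^ lam i) := by
      rw [← eval_esymmPow]
      refine ((hasSum_coeff_mul_prod_pow _ _).mul_left _).congr_fun fun ν => ?_
      simp only [H, Real.norm_eq_abs, abs_mul, Finset.abs_prod, abs_pow,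
        abs_of_nonneg (coeff_esymmPow_nonneg lam ν)]
    have hH : Summable H := by
      refine Summable.of_norm ((summable_prod_of_nonneg fun q => norm_nonneg _).mpr
        ⟨fun lam => (hrowabs lam).summable, ?_⟩)
      refine Summable.of_nonneg_of_le (fun lam => tsum_nonneg fun ν => norm_nonneg _)
        (fun lam => ?_) hb
      rw [(hrowabs lam).tsum_eq]
      exact mul_le_mul_of_nonneg_left ((le_abs_self _).trans (prod_norm_pow_le hxabs lam))
        (abs_nonneg _)
    have htotal : HasSum H (f x) := by
      have h1 := hH.hasSum.prod_fiberwise hrow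
      rw [hfx, ← h1.unique (hgb _ hx)]
      exact hH.hasSum
    have hswap := (Equiv.prodComm (Fin n →₀ ℕ) (Fin n →₀ ℕ)).hasSum_iff.mpr htotal
    refine hswap.prod_fiberwise fun ν => ?_
    rw [Finset.sum_mul]
    -- By homogeneity of σ^λ, only the finitely many λ of weight |ν| contribute to x^ν.
    have hzero : ∀ lam ∉ multiIndicesOfWeight n (multiDegree ν), H (lam, ν) = 0 := by
      intro lam hlam
      simp only [H]
      rw [coeff_esymmPow_eq_zero fun h => hlam (mem_multiIndicesOfWeight.mpr h.symm), zero_mul,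
        mul_zero]
    have h1 := hasSum_sum_of_ne_finset_zero (L := .unconditional _) hzero
    rw [Finset.sum_congr rfl fun lam _ => show H (lam, ν) =
      faaDiBrunoCoeff ν lam * b lam * ∏ i, x i ^ ν i by
        rw [faaDiBrunoCoeff_eq_coeff]; simp only [H]; ring] at h1
    exact h1
  · filter_upwards [Metric.closedBall_mem_nhds (0 : Fin n → ℝ) hρ] with y hy
    exact hgb y (mem_closedBall_zero_iff.mp hy)

theorem exists_polynomial_of_eval_eq {n : ℕ} {V : Set (Fin n → ℝ)} (hV : IsOpen V)
    (h0 : (0 : Fin n → ℝ) ∈ V) {f : (Fin n → ℝ) → ℝ}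
    (hsymm : ∀ π : Equiv.Perm (Fin n), ∀ x ∈ V, (fun i => x (π i)) ∈ V →
      f (fun i => x (π i)) = f x) {p : MvPolynomial (Fin n) ℝ}
    (hp : ∀ x ∈ V, f x = MvPolynomial.eval x p) :
    ∃ q : MvPolynomial (Fin n) ℝ, q.totalDegree ≤ p.totalDegree ∧
      ∀ x, MvPolynomial.eval x p = MvPolynomial.eval (elemSymm n x) q := by
  -- Symmetry is known only on V, but 0 is fixed by all permutations and a polynomial identity near
  -- 0 is global.
  have hps : p.IsSymmetric := isSymmetric_of_eventually fun π => by
    have h := (continuous_perm_comp (n := n) π).tendsto 0 (hV.mem_nhds h0)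
    filter_upwards [hV.mem_nhds h0, h] with x hx hxπ
    rw [← hp _ hxπ, hsymm π x hx hxπ, hp x hx]
  obtain ⟨q, rfl⟩ := exists_esymmSubst_eq hps
  exact ⟨q, totalDegree_le_totalDegree_esymmSubst q, fun x => eval_esymmSubst q x⟩

end

/-! ### The symmetric function theorem. -/

theorem mainTheorem1 (n : ℕ) (hn : n ≠ 0) (V : Set (Fin n → ℝ)) (hV : IsOpen V)
    (h0 : (0 : Fin n → ℝ) ∈ V) (f : (Fin n → ℝ) → ℝ) (hf : AnalyticOnNhd ℝ f V)
    (hsymm : ∀ (π : Equiv.Perm (Fin n)), ∀ x ∈ V,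
      (fun i => x (π⁻¹ i)) ∈ V → f (fun i => x (π⁻¹ i)) = f x) :
    (∃ g : (Fin n → ℝ) → ℝ,
      -- existence: `g` is analytic on an open neighbourhood of `σ(V)` and `f = g ∘ σ` on `V`
      AnalyticOnNhd ℝ g (elemSymm n '' V) ∧
      (∀ x ∈ V, f x = g (elemSymm n x)) ∧
      -- uniqueness near `σ(V)`
      (∀ g' : (Fin n → ℝ) → ℝ, AnalyticOnNhd ℝ g' (elemSymm n '' V) →
        (∀ x ∈ V, f x = g' (elemSymm n x)) → g' =ᶠ[𝓝ˢ (elemSymm n '' V)] g) ∧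
      -- uniqueness as a germ at the origin
      (∀ g' : (Fin n → ℝ) → ℝ, AnalyticAt ℝ g' 0 →
        (∀ᶠ x in 𝓝 (0 : Fin n → ℝ), f x = g' (elemSymm n x)) →
        g' =ᶠ[𝓝 (0 : Fin n → ℝ)] g) ∧
      -- polynomials
      (∀ p : MvPolynomial (Fin n) ℝ, (∀ x ∈ V, f x = MvPolynomial.eval x p) →
        ∃ q : MvPolynomial (Fin n) ℝ, q.totalDegree ≤ p.totalDegree ∧
          ∀ᶠ y in 𝓝ˢ (elemSymm n '' V), g y = MvPolynomial.eval y q) ∧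
      -- the power series coefficients of `f` and `g` satisfy the linear system
      (∃ a b : (Fin n →₀ ℕ) → ℝ, HasPowerSeriesAtZero f a ∧ HasPowerSeriesAtZero g b ∧
        ∀ ν : Fin n →₀ ℕ,
          a ν = ∑ lam ∈ multiIndicesOfWeight n (multiDegree ν), faaDiBrunoCoeff ν lam * b lam)) ∧
    -- in each weight `d` the system is square and unitriangular
    (∀ d : ℕ,
      Set.BijOn diffMap (decreasingOfDegree n d) {lam : Fin n →₀ ℕ | multiWeight lam = d} ∧
      (∀ ν ∈ decreasingOfDegree n d, faaDiBrunoCoeff ν (diffMap ν) = 1) ∧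
      (∀ ν ∈ decreasingOfDegree n d, ∀ μ ∈ decreasingOfDegree n d,
        toLex μ < toLex ν → faaDiBrunoCoeff ν (diffMap μ) = 0)) := by
  have hsymm' (π : Equiv.Perm (Fin n)) : ∀ x ∈ V, (fun i => x (π i)) ∈ V →
      f (fun i => x (π i)) = f x := by
    simpa only [inv_inv] using hsymm π⁻¹
  refine ⟨?_, fun d => ⟨bijOn_diffMap n d, fun ν hν => ?_, fun ν _ μ hμ hlt => ?_⟩⟩
  · obtain ⟨g, hg, hfg⟩ := exists_analyticOnNhd_comp_elemSymm hV hf hsymm'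
    have hfg0 : ∀ᶠ x in 𝓝 (0 : Fin n → ℝ), f x = g (elemSymm n x) :=
      eventually_of_mem (hV.mem_nhds h0) hfg
    have hg0 : AnalyticAt ℝ g 0 := hg 0 ⟨0, h0, elemSymm_zero n⟩
    have huniq : ∀ g' : (Fin n → ℝ) → ℝ, AnalyticOnNhd ℝ g' (elemSymm n '' V) →
        (∀ x ∈ V, f x = g' (elemSymm n x)) → g' =ᶠ[𝓝ˢ (elemSymm n '' V)] g := by
      intro g' hg' hfg'
      refine eventually_nhdsSet_iff_forall.mpr ?_
      rintro _ ⟨a, ha, rfl⟩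
      refine eventuallyEq_of_comp_elemSymm (hg' _ ⟨a, ha, rfl⟩) (hg _ ⟨a, ha, rfl⟩) ?_
      filter_upwards [hV.mem_nhds ha] with x hx
      rw [← hfg' x hx, hfg x hx]
    refine ⟨g, hg, hfg, huniq, fun g' hg' hfg' => ?_, fun p hp => ?_,
      exists_powerSeries_comp_elemSymm hg0 hfg0⟩
    · rw [← elemSymm_zero n] at hg' hg0 ⊢
      refine eventuallyEq_of_comp_elemSymm hg' hg0 ?_
      filter_upwards [hfg', hfg0] with x h1 h2
      rw [← h1, h2]
    · obtain ⟨q, hq, hpq⟩ := exists_polynomial_of_eval_eq hV h0 hsymm' hp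
      have hqa : AnalyticOnNhd ℝ (fun y => MvPolynomial.eval y q) (elemSymm n '' V) :=
        (AnalyticOnNhd.eval_mvPolynomial q).mono (Set.subset_univ _)
      refine ⟨q, hq, (huniq _ hqa fun x hx => ?_).symm⟩
      rw [hp x hx, hpq]
  · rw [faaDiBrunoCoeff_eq_coeff, coeff_esymmPow_diffMap_self hν.1]
  · rw [faaDiBrunoCoeff_eq_coeff, coeff_esymmPow_diffMap_of_lt hμ.1 hlt]
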